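/- An Arens–Michael algebra is a complete Hausdorff topological $\mathbb{C}$-algebra (unital) whose topology is given by submultiplicative seminorms. Let $\mathcal{F}_n$ be the algebra of free entire functions in $n$ generators, i.e. the completion of the free algebra $\mathbb{C}\langle\zeta_1,\dots,\zeta_n\rangle$ with respect to all its submultiplicative seminorms. A Fréchet Arens–Michael algebra $A$ is holomorphically finitely generated (HFG) if for some $n$ there are $s_1,\dots,s_n\in A$ such that every element of $A$ is a free entire function of $s_1,\dots,s_n$, i.e. the continuous unital homomorphism $\mathcal{F}_n\to A$, $\zeta_i\mapsto s_i$, is surjective. Let $\widehat\otimes$ be the completed projective tensor product; a Hopf $\widehat\otimes$-algebra is a Hopf algebra in the monoidal category of complete locally convex spaces with $\widehat\otimes$, and an HFG Hopf algebra is a Hopf $\widehat\otimes$-algebra that is HFG as an algebra. **Proposition.** Let $q\in\mathbb{C}\setminus\{0\}$, and let $\mathcal{O}(\widetilde{\mathrm{Af}}_1)_q$ be the quotient of $\mathcal{F}_2$, with generators denoted by $z$ and $b$, by the closed two-sided ideal generated by $e^zb-q\,be^z$. Then: 1. $\mathcal{O}(\widetilde{\mathrm{Af}}_1)_q$ is the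 universal HFG algebra generated by $z$ and $b$ subject to the relation $e^zb=q\,be^z$: it is an HFG algebra, $z$ and $b$ generate it topologically and satisfy the relation, and for every HFG algebra $B$ and all $x,y\in B$ with $e^xy=q\,ye^x$ there is a unique continuous unital homomorphism $\mathcal{O}(\widetilde{\mathrm{Af}}_1)_q\to B$ with $z\mapsto x$ and $b\mapsto y$. 2. $\mathcal{O}(\widetilde{\mathrm{Af}}_1)_q$ is infinite-dimensional. 3. $\mathcal{O}(\widetilde{\mathrm{Af}}_1)_q$ is an HFG Hopf algebra with respect to the comultiplication $\Delta$ and the counit $\varepsilon$ (continuous unital homomorphisms) and the antipode $S$ (a continuous unital antihomomorphism) determined by $$\Delta(z)=1\otimes z+z\otimes 1,\qquad \Delta(b)=e^z\otimes b+b\otimes 1,$$ $$S(z)=-z,\qquad S(b)=-e^{-z}b,\qquad \varepsilon(z)=\varepsilon(b)=0;$$ that is, there is exactly one Hopf $\widehat\otimes$-algebra structure on this algebra whose antipode is a unital antihomomorphism and that satisfies these formulas. 4. The antipode $S$ is invertible (it is a topological linear automorphism). -/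

import Mathlib

open UniformSpace Topology TensorProduct

universe u

noncomputable section

/-! ## Complex locally convex spaces and seminorms -/

section Seminorms

variable {A B E : Type*} [AddCommGroup A] [Module ℂ A] [AddCommGroup B] [Module ℂ B]
  [AddCommGroup E] [Module ℂ E]

theorem exists_seminorm_ball_subset [TopologicalSpace A] [PolynormableSpace ℂ A]
    {U : Set A} (hU : U ∈ 𝓝 (0 : A)) :
    ∃ p : Seminorm ℂ A, Continuous p ∧ {x | p x < 1} ⊆ U := by
  have hw := PolynormableSpace.withSeminorms ℂ A
  have := hw.topologicalAddGroup
  obtain ⟨s, r, hr, hs⟩ := (hw.mem_nhds_iff 0 U).1 hU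
  have hc := Seminorm.continuous_finsetSup
    (p := fun p : {p : Seminorm ℂ A // Continuous p} ↦ p.1) (s := s) (fun i _ ↦ i.2)
  refine ⟨(r⁻¹).toNNReal • s.sup (fun p : {p : Seminorm ℂ A // Continuous p} ↦ p.1), ?_, ?_⟩
  · exact continuous_const.mul hc
  · intro x hx
    apply hs
    rw [Seminorm.mem_ball_zero]
    have h : ((r⁻¹).toNNReal : ℝ) *
      (s.sup (fun p : {p : Seminorm ℂ A // Continuous p} ↦ p.1)) x < 1 := hx
    rw [Real.coe_toNNReal _ (by positivity)] at h
    rwa [inv_mul_lt_iff₀ hr, mul_one] at h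

theorem polynormableSpace_of_balls [TopologicalSpace A] [IsTopologicalAddGroup A]
    (h : ∀ U ∈ 𝓝 (0 : A), ∃ p : Seminorm ℂ A, Continuous p ∧ {x | p x < 1} ⊆ U) :
    PolynormableSpace ℂ A where
  withSeminorms' := by
    rw [SeminormFamily.withSeminorms_iff_nhds_eq_iInf]
    refine le_antisymm ?_ ?_
    · simp_rw [le_iInf_iff, ← Filter.tendsto_iff_comap]
      intro ⟨p, hp⟩
      exact hp.tendsto' 0 0 (map_zero _)
    · intro U hU
      obtain ⟨p, hp, hpU⟩ := h U hU
      exact Filter.mem_iInf_of_mem (⟨p, hp⟩ : {p : Seminorm ℂ A // Continuous p})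
        (Filter.mem_comap.2 ⟨Set.Iio 1, Iio_mem_nhds one_pos, hpU⟩)

/-- The uniform structure generated by a family of seminorms. -/
@[reducible]
def seminormUniformSpace {ι : Type*} (p : ι → Seminorm ℂ E) : UniformSpace E :=
  ⨅ i, (p i).toSeminormedAddCommGroup.toUniformSpace

theorem isUniformAddGroup_seminorm {ι : Type*} (p : ι → Seminorm ℂ E) :
    letI := seminormUniformSpace p
    IsUniformAddGroup E :=
  isUniformAddGroup_iInf fun _ ↦ inferInstance

theorem withSeminorms_seminorm {ι : Type*} (p : ι → Seminorm ℂ E) :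
    letI := seminormUniformSpace p
    WithSeminorms p := by
  let _ := seminormUniformSpace p
  have := isUniformAddGroup_seminorm p
  exact (SeminormFamily.withSeminorms_iff_uniformSpace_eq_iInf p).2 rfl

/-- An absolutely homogeneous function of two variables that is continuous at the origin is
dominated by a product of continuous seminorms. -/
theorem exists_seminorm_mul_bound [TopologicalSpace A] [PolynormableSpace ℂ A]
    [TopologicalSpace B] [PolynormableSpace ℂ B] (g : A → B → ℝ)
    (hl : ∀ (c : ℂ) a b, g (c • a) b = ‖c‖ * g a b)
    (hr : ∀ (c : ℂ) a b, g a (c • b) = ‖c‖ * g a b)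
    (hg : Continuous fun x : A × B ↦ g x.1 x.2) :
    ∃ (p : Seminorm ℂ A) (q : Seminorm ℂ B), Continuous p ∧ Continuous q ∧
      ∀ a b, g a b ≤ p a * q b := by
  have h0 : g 0 0 = 0 := by simpa using hl 0 0 0
  have h1 : {x : A × B | g x.1 x.2 < 1} ∈ 𝓝 ((0 : A), (0 : B)) :=
    (isOpen_lt hg continuous_const).mem_nhds (by simp [h0])
  obtain ⟨U, hU, V, hV, hUV⟩ := mem_nhds_prod_iff.1 h1
  obtain ⟨p, hp, hpU⟩ := exists_seminorm_ball_subset hU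
  obtain ⟨q, hq, hqV⟩ := exists_seminorm_ball_subset hV
  refine ⟨p, q, hp, hq, fun a b ↦ ?_⟩
  have key : ∀ ε > (0 : ℝ), g a b ≤ (p a + ε) * (q b + ε) := by
    intro ε hε
    have hpa : 0 < p a + ε := add_pos_of_nonneg_of_pos (apply_nonneg p a) hε
    have hqb : 0 < q b + ε := add_pos_of_nonneg_of_pos (apply_nonneg q b) hε
    have ha : ((p a + ε : ℝ) : ℂ)⁻¹ • a ∈ U := by
      apply hpU
      simp only [Set.mem_ofPred_eq, map_smul_eq_mul, norm_inv, Complex.norm_real, Real.norm_eq_abs,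
        abs_of_pos hpa]
      rw [inv_mul_lt_iff₀ hpa]; linarith
    have hb : ((q b + ε : ℝ) : ℂ)⁻¹ • b ∈ V := by
      apply hqV
      simp only [Set.mem_ofPred_eq, map_smul_eq_mul, norm_inv, Complex.norm_real, Real.norm_eq_abs,
        abs_of_pos hqb]
      rw [inv_mul_lt_iff₀ hqb]; linarith
    have h2 : g (((p a + ε : ℝ) : ℂ)⁻¹ • a) (((q b + ε : ℝ) : ℂ)⁻¹ • b) < 1 :=
      hUV (Set.mk_mem_prod ha hb)
    rw [hl, hr, norm_inv, norm_inv, Complex.norm_real, Complex.norm_real, Real.norm_eq_abs,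
      Real.norm_eq_abs, abs_of_pos hpa, abs_of_pos hqb, inv_mul_lt_iff₀ hpa,
      inv_mul_lt_iff₀ hqb] at h2
    linarith
  have hlim : Filter.Tendsto (fun ε : ℝ ↦ (p a + ε) * (q b + ε)) (𝓝[>] 0)
      (𝓝 ((p a + 0) * (q b + 0))) := by
    refine Filter.Tendsto.mono_left (Continuous.tendsto (by fun_prop) 0) nhdsWithin_le_nhds
  simp only [add_zero] at hlim
  exact ge_of_tendsto hlim (eventually_nhdsWithin_of_forall key)

/-- A bilinear map `f` is jointly continuous if `p ∘ f` is, for all `p` in a defining family. -/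
theorem continuous_bilinear_of_seminorm {ι : Type*} [TopologicalSpace A] [IsTopologicalAddGroup A]
    [TopologicalSpace B] [IsTopologicalAddGroup B] [TopologicalSpace E]
    {p : SeminormFamily ℂ E ι} (hp : WithSeminorms p) (f : A →ₗ[ℂ] B →ₗ[ℂ] E)
    (hf : ∀ i, Continuous fun x : A × B ↦ p i (f x.1 x.2)) :
    Continuous fun x : A × B ↦ f x.1 x.2 := by
  rw [continuous_iff_continuousAt]
  rintro ⟨a₀, b₀⟩
  refine (hp.tendsto_nhds _ _).2 fun i ε hε ↦ ?_
  have hlim : Continuous fun x : A × B ↦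
      p i (f (x.1 - a₀) x.2) + p i (f a₀ (x.2 - b₀)) :=
    ((hf i).comp ((continuous_fst.sub continuous_const).prodMk continuous_snd)).add
      ((hf i).comp (continuous_const.prodMk (continuous_snd.sub continuous_const)))
  have h0 := hlim.tendsto (a₀, b₀)
  simp only [sub_self, map_zero, LinearMap.zero_apply, add_zero] at h0
  filter_upwards [h0.eventually (Iio_mem_nhds hε)] with x hx
  refine lt_of_le_of_lt ?_ hx
  have : f x.1 x.2 - f a₀ b₀ = f (x.1 - a₀) x.2 + f a₀ (x.2 - b₀) := by
    simp
  rw [this]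
  exact map_add_le_add (p i) _ _

theorem continuous_seminorm_bilinear_of_bound [TopologicalSpace A] [IsTopologicalAddGroup A]
    [TopologicalSpace B] [IsTopologicalAddGroup B] (f : A →ₗ[ℂ] B →ₗ[ℂ] E) (s : Seminorm ℂ E)
    {p : Seminorm ℂ A} {q : Seminorm ℂ B} (hp : Continuous p) (hq : Continuous q)
    (h : ∀ a b, s (f a b) ≤ p a * q b) : Continuous fun x : A × B ↦ s (f x.1 x.2) := by
  rw [continuous_iff_continuousAt]
  rintro ⟨a₀, b₀⟩
  have hlim : Continuous fun x : A × B ↦ p (x.1 - a₀) * q x.2 + p a₀ * q (x.2 - b₀) := by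
    fun_prop
  have h0 := hlim.tendsto (a₀, b₀)
  simp only [sub_self, map_zero, zero_mul, mul_zero, add_zero] at h0
  rw [ContinuousAt, tendsto_iff_norm_sub_tendsto_zero]
  refine squeeze_zero (fun _ ↦ norm_nonneg _) (fun x ↦ ?_) h0
  have : f x.1 x.2 - f a₀ b₀ = f (x.1 - a₀) x.2 + f a₀ (x.2 - b₀) := by
    simp
  rw [Real.norm_eq_abs]
  refine (abs_sub_map_le_sub s _ _).trans ?_
  rw [this]
  exact (map_add_le_add s _ _).trans (add_le_add (h _ _) (h _ _))

/-- A bilinear map is jointly continuous if it satisfies seminorm estimates. -/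
theorem continuous_bilinear_of_bound [TopologicalSpace A] [IsTopologicalAddGroup A]
    [TopologicalSpace B] [IsTopologicalAddGroup B]
    [TopologicalSpace E] [PolynormableSpace ℂ E] (f : A →ₗ[ℂ] B →ₗ[ℂ] E)
    (hf : ∀ s : Seminorm ℂ E, Continuous s →
      ∃ (p : Seminorm ℂ A) (q : Seminorm ℂ B), Continuous p ∧ Continuous q ∧
        ∀ a b, s (f a b) ≤ p a * q b) :
    Continuous fun x : A × B ↦ f x.1 x.2 :=
  continuous_bilinear_of_seminorm (PolynormableSpace.withSeminorms ℂ E) f fun s ↦ by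
    obtain ⟨p, q, hp, hq, h⟩ := hf s.1 s.2
    exact continuous_seminorm_bilinear_of_bound f s.1 hp hq h

/-- A linear map is continuous if it pulls continuous seminorms back to continuous seminorms. -/
theorem continuous_linear_of_seminorm [TopologicalSpace A] [IsTopologicalAddGroup A]
    [TopologicalSpace E] [IsTopologicalAddGroup E] [PolynormableSpace ℂ E] (f : A →ₗ[ℂ] E)
    (hf : ∀ s : Seminorm ℂ E, Continuous s → Continuous (s.comp f)) : Continuous f := by
  refine continuous_of_continuousAt_zero f ?_
  rw [ContinuousAt, map_zero]
  intro U hU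
  obtain ⟨s, hs, hsU⟩ := exists_seminorm_ball_subset hU
  have h1 : {x | s.comp f x < 1} ∈ 𝓝 (0 : A) :=
    (isOpen_lt (hf s hs) continuous_const).mem_nhds (by simp)
  exact Filter.mem_of_superset h1 fun x hx ↦ hsU hx

/-- The extension of a continuous seminorm to the completion. -/
def Seminorm.completion [UniformSpace E] [IsUniformAddGroup E] [UniformContinuousConstSMul ℂ E]
    (p : Seminorm ℂ E) (hp : UniformContinuous p) : Seminorm ℂ (Completion E) :=
  Seminorm.of (Completion.extension p)
    (fun x y ↦ by
      refine Completion.induction_on₂ x y (isClosed_le ?_ ?_) fun a b ↦ ?_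
      · exact Completion.continuous_extension.comp continuous_add
      · exact (Completion.continuous_extension.comp continuous_fst).add
          (Completion.continuous_extension.comp continuous_snd)
      · rw [← Completion.coe_add, Completion.extension_coe hp, Completion.extension_coe hp,
          Completion.extension_coe hp]
        exact map_add_le_add p a b)
    (fun c x ↦ by
      refine Completion.induction_on x (isClosed_eq ?_ ?_) fun a ↦ ?_
      · exact Completion.continuous_extension.comp (continuous_const_smul c)
      · exact continuous_const.mul Completion.continuous_extension
      · rw [← Completion.coe_smul, Completion.extension_coe hp, Completion.extension_coe hp,
          map_smul_eq_mul])

theorem Seminorm.completion_coe [UniformSpace E] [IsUniformAddGroup E]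
    [UniformContinuousConstSMul ℂ E] (p : Seminorm ℂ E) (hp : UniformContinuous p) (x : E) :
    p.completion hp x = p x :=
  Completion.extension_coe hp x

theorem Seminorm.continuous_completion [UniformSpace E] [IsUniformAddGroup E]
    [UniformContinuousConstSMul ℂ E] (p : Seminorm ℂ E) (hp : UniformContinuous p) :
    Continuous (p.completion hp) :=
  Completion.continuous_extension

instance Completion.polynormableSpace [UniformSpace E] [IsUniformAddGroup E]
    [UniformContinuousConstSMul ℂ E] [PolynormableSpace ℂ E] :
    PolynormableSpace ℂ (Completion E) := by
  refine polynormableSpace_of_balls fun U hU ↦ ?_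
  obtain ⟨W, hW, hWc, hWU⟩ := exists_mem_nhds_isClosed_subset hU
  have h1 : ((↑) : E → Completion E) ⁻¹' W ∈ 𝓝 (0 : E) :=
    (Completion.continuous_coe E).continuousAt.preimage_mem_nhds (by rwa [Completion.coe_zero])
  obtain ⟨p, hp, hpW⟩ := exists_seminorm_ball_subset h1
  have hu : UniformContinuous p := Seminorm.uniformContinuous_of_continuousAt_zero hp.continuousAt
  refine ⟨p.completion hu, p.continuous_completion hu, fun x hx ↦ hWU ?_⟩
  have ho : IsOpen {y | p.completion hu y < 1} :=
    isOpen_lt (p.continuous_completion hu) continuous_const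
  have hd : Dense (Set.range ((↑) : E → Completion E)) := Completion.denseRange_coe
  have h2 := hd.open_subset_closure_inter ho hx
  refine hWc.closure_subset_iff.2 ?_ h2
  rintro y ⟨hy, e, rfl⟩
  have h3 : p.completion hu e < 1 := hy
  rw [Seminorm.completion_coe] at h3
  exact hpW h3

/-- The projective tensor product `p ⊗ q` of two seminorms: the largest seminorm on `A ⊗ B` that is
at most `p a * q b` on every elementary tensor `a ⊗ b`. -/
def projSeminorm (p : Seminorm ℂ A) (q : Seminorm ℂ B) : Seminorm ℂ (A ⊗[ℂ] B) :=
  sSup {r | ∀ a b, r (a ⊗ₜ b) ≤ p a * q b}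

theorem bddAbove_projSeminorm (p : Seminorm ℂ A) (q : Seminorm ℂ B) :
    BddAbove {r : Seminorm ℂ (A ⊗[ℂ] B) | ∀ a b, r (a ⊗ₜ b) ≤ p a * q b} := by
  rw [Seminorm.bddAbove_iff]
  have h : ∀ u : A ⊗[ℂ] B, ∃ M : ℝ, ∀ r : Seminorm ℂ (A ⊗[ℂ] B),
      (∀ a b, r (a ⊗ₜ b) ≤ p a * q b) → r u ≤ M := by
    intro u
    induction u using TensorProduct.induction_on with
    | zero => exact ⟨0, fun r _ ↦ (map_zero r).le⟩
    | tmul a b => exact ⟨_, fun r hr ↦ hr a b⟩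
    | add u v hu hv =>
      obtain ⟨M, hM⟩ := hu
      obtain ⟨N, hN⟩ := hv
      exact ⟨M + N, fun r hr ↦ (map_add_le_add r u v).trans (add_le_add (hM r hr) (hN r hr))⟩
  choose M hM using h
  refine ⟨M, ?_⟩
  rintro _ ⟨r, hr, rfl⟩ u
  exact hM u r hr

theorem le_projSeminorm {p : Seminorm ℂ A} {q : Seminorm ℂ B} {r : Seminorm ℂ (A ⊗[ℂ] B)}
    (hr : ∀ a b, r (a ⊗ₜ b) ≤ p a * q b) : r ≤ projSeminorm p q :=
  le_csSup (bddAbove_projSeminorm p q) hr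

theorem projSeminorm_tmul_le (p : Seminorm ℂ A) (q : Seminorm ℂ B) (a : A) (b : B) :
    projSeminorm p q (a ⊗ₜ b) ≤ p a * q b := by
  have : Nonempty {r : Seminorm ℂ (A ⊗[ℂ] B) | ∀ a b, r (a ⊗ₜ b) ≤ p a * q b} :=
    ⟨0, fun a b ↦ mul_nonneg (apply_nonneg p a) (apply_nonneg q b)⟩
  rw [projSeminorm, Seminorm.sSup_apply (bddAbove_projSeminorm p q)]
  exact ciSup_le fun r ↦ r.2 a b

theorem le_mul_projSeminorm {p : Seminorm ℂ A} {q : Seminorm ℂ B} {r : Seminorm ℂ (A ⊗[ℂ] B)}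
    {K : ℝ} (hK : 0 ≤ K) (hr : ∀ a b, r (a ⊗ₜ b) ≤ K * (p a * q b)) (u : A ⊗[ℂ] B) :
    r u ≤ K * projSeminorm p q u := by
  have key : ∀ ε > (0 : ℝ), r u ≤ (K + ε) * projSeminorm p q u := by
    intro ε hε
    have hKε : 0 < K + ε := by linarith
    have h1 : (K + ε)⁻¹.toNNReal • r ≤ projSeminorm p q := by
      refine le_projSeminorm fun a b ↦ ?_
      change ((K + ε)⁻¹.toNNReal : ℝ) * r (a ⊗ₜ b) ≤ _
      rw [Real.coe_toNNReal _ (by positivity), inv_mul_le_iff₀ hKε]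
      have := mul_nonneg (apply_nonneg p a) (apply_nonneg q b)
      nlinarith [hr a b]
    have h2 : ((K + ε)⁻¹.toNNReal : ℝ) * r u ≤ projSeminorm p q u := h1 u
    rwa [Real.coe_toNNReal _ (by positivity), inv_mul_le_iff₀ hKε] at h2
  have hlim : Filter.Tendsto (fun ε : ℝ ↦ (K + ε) * projSeminorm p q u) (𝓝[>] 0)
      (𝓝 ((K + 0) * projSeminorm p q u)) :=
    Filter.Tendsto.mono_left (Continuous.tendsto (by fun_prop) 0) nhdsWithin_le_nhds
  simp only [add_zero] at hlim
  exact ge_of_tendsto hlim (eventually_nhdsWithin_of_forall key)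

end Seminorms

/-! ## The projective tensor product -/

section Projective

variable {A B C D E : Type*} [AddCommGroup A] [Module ℂ A] [TopologicalSpace A]
  [AddCommGroup B] [Module ℂ B] [TopologicalSpace B]
  [AddCommGroup C] [Module ℂ C] [TopologicalSpace C]
  [AddCommGroup D] [Module ℂ D] [TopologicalSpace D]
  [AddCommGroup E] [Module ℂ E]

variable (A B) in
/-- The seminorms `r` on `A ⊗ B` for which `(a, b) ↦ r (a ⊗ b)` is continuous on `A × B`. -/
def projectiveSeminorms :
    {r : Seminorm ℂ (A ⊗[ℂ] B) // Continuous fun x : A × B ↦ r (x.1 ⊗ₜ[ℂ] x.2)} →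
      Seminorm ℂ (A ⊗[ℂ] B) :=
  fun r ↦ r.1

/-- The projective topology on `A ⊗ B`: the finest locally convex topology for which the canonical
bilinear map `A × B → A ⊗ B` is (jointly) continuous. -/
instance TensorProduct.projectiveUniformSpace : UniformSpace (A ⊗[ℂ] B) :=
  seminormUniformSpace (projectiveSeminorms A B)

instance TensorProduct.projectiveIsUniformAddGroup : IsUniformAddGroup (A ⊗[ℂ] B) :=
  isUniformAddGroup_seminorm _

theorem withSeminorms_projective : WithSeminorms (projectiveSeminorms A B) :=
  withSeminorms_seminorm _

instance TensorProduct.projectivePolynormableSpace : PolynormableSpace ℂ (A ⊗[ℂ] B) :=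
  withSeminorms_projective.toPolynormableSpace

instance TensorProduct.projectiveContinuousSMul : ContinuousSMul ℂ (A ⊗[ℂ] B) :=
  withSeminorms_projective.continuousSMul

instance TensorProduct.projectiveUniformContinuousConstSMul :
    UniformContinuousConstSMul ℂ (A ⊗[ℂ] B) :=
  uniformContinuousConstSMul_of_continuousConstSMul _ _

theorem continuous_seminorm_projective {r : Seminorm ℂ (A ⊗[ℂ] B)}
    (hr : Continuous fun x : A × B ↦ r (x.1 ⊗ₜ[ℂ] x.2)) : Continuous r :=
  withSeminorms_projective.continuous_seminorm ⟨r, hr⟩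

theorem continuous_projective_tmul [IsTopologicalAddGroup A] [IsTopologicalAddGroup B] :
    Continuous fun x : A × B ↦ x.1 ⊗ₜ[ℂ] x.2 :=
  continuous_bilinear_of_seminorm withSeminorms_projective (TensorProduct.mk ℂ A B) fun i ↦ i.2

theorem continuous_projSeminorm [IsTopologicalAddGroup A] [IsTopologicalAddGroup B]
    {p : Seminorm ℂ A} {q : Seminorm ℂ B} (hp : Continuous p) (hq : Continuous q) :
    Continuous (projSeminorm p q) :=
  continuous_seminorm_projective <|
    continuous_seminorm_bilinear_of_bound (TensorProduct.mk ℂ A B) _ hp hq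
      (projSeminorm_tmul_le p q)

variable (A B) in
/-- The completed projective tensor product `A ⊗̂ B`. -/
abbrev CTensor : Type _ := Completion (A ⊗[ℂ] B)

namespace CTensor

variable (A B) in
/-- The canonical continuous linear map `A ⊗ B → A ⊗̂ B`. -/
def ofTensor : A ⊗[ℂ] B →L[ℂ] CTensor A B where
  toFun u := u
  map_add' u v := Completion.coe_add u v
  map_smul' c u := Completion.coe_smul c u
  cont := Completion.continuous_coe _

variable (A B) in
/-- The elementary tensor `a ⊗ b` in `A ⊗̂ B`, as a bilinear map. -/
def mk : A →ₗ[ℂ] B →ₗ[ℂ] CTensor A B :=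
  (TensorProduct.mk ℂ A B).compr₂ (ofTensor A B).toLinearMap

/-- The elementary tensor `a ⊗ b` in `A ⊗̂ B`. -/
def tmul (a : A) (b : B) : CTensor A B := mk A B a b

theorem tmul_eq_coe (a : A) (b : B) :
    tmul a b = ((a ⊗ₜ[ℂ] b : A ⊗[ℂ] B) : Completion (A ⊗[ℂ] B)) := rfl

theorem add_tmul (a a' : A) (b : B) : tmul (a + a') b = tmul a b + tmul a' b := by
  simp [tmul]

theorem smul_tmul (k : ℂ) (a : A) (b : B) : tmul (k • a) b = k • tmul a b := by
  simp [tmul]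

theorem tmul_add (a : A) (b b' : B) : tmul a (b + b') = tmul a b + tmul a b' := by
  simp [tmul]

theorem tmul_smul (k : ℂ) (a : A) (b : B) : tmul a (k • b) = k • tmul a b := by
  simp [tmul]

theorem continuous_tmul [IsTopologicalAddGroup A] [IsTopologicalAddGroup B] :
    Continuous fun x : A × B ↦ tmul x.1 x.2 :=
  (Completion.continuous_coe _).comp continuous_projective_tmul

theorem ext [TopologicalSpace E] [T2Space E] {f g : CTensor A B →L[ℂ] E} (h : ∀ a b, f (tmul a b) = g (tmul a b)) : f = g := by
  ext t
  induction t using Completion.induction_on with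
  | hp => exact isClosed_eq f.continuous g.continuous
  | ih u =>
    induction u using TensorProduct.induction_on with
    | zero => rw [Completion.coe_zero, map_zero, map_zero]
    | tmul a b => exact h a b
    | add u v hu hv => rw [Completion.coe_add, map_add, map_add, hu, hv]

section Lift

variable [UniformSpace E] [IsUniformAddGroup E] [PolynormableSpace ℂ E]
  [UniformContinuousConstSMul ℂ E]

/-- The continuous linear map `A ⊗ B → E` induced by a jointly continuous bilinear map. -/
def preLift (f : A →ₗ[ℂ] B →ₗ[ℂ] E) (hf : Continuous fun x : A × B ↦ f x.1 x.2) :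
    A ⊗[ℂ] B →L[ℂ] E where
  toLinearMap := TensorProduct.lift f
  cont := continuous_linear_of_seminorm _ fun s hs ↦
    continuous_seminorm_projective (r := s.comp (TensorProduct.lift f)) (hs.comp hf)

variable [CompleteSpace E] [T0Space E]

/-- The continuous linear map `A ⊗̂ B → E`, `a ⊗ b ↦ f a b`, induced by a jointly continuous
bilinear map `f` to a complete locally convex space. -/
def lift (f : A →ₗ[ℂ] B →ₗ[ℂ] E) (hf : Continuous fun x : A × B ↦ f x.1 x.2) :
    CTensor A B →L[ℂ] E :=
  (preLift f hf).fromCompletion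

@[simp]
theorem lift_tmul (f : A →ₗ[ℂ] B →ₗ[ℂ] E) (hf : Continuous fun x : A × B ↦ f x.1 x.2)
    (a : A) (b : B) : lift f hf (tmul a b) = f a b := by
  rw [lift, tmul_eq_coe, ContinuousLinearMap.fromCompletion_apply_coe]
  exact TensorProduct.lift.tmul a b

end Lift

variable [IsTopologicalAddGroup C] [IsTopologicalAddGroup D]

/-- The completed tensor product `f ⊗̂ g` of two continuous linear maps. -/
def map (f : A →L[ℂ] C) (g : B →L[ℂ] D) : CTensor A B →L[ℂ] CTensor C D :=
  lift ((mk C D).compl₁₂ f.toLinearMap g.toLinearMap)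
    (continuous_tmul.comp ((f.continuous.comp continuous_fst).prodMk
      (g.continuous.comp continuous_snd)))

@[simp]
theorem map_tmul (f : A →L[ℂ] C) (g : B →L[ℂ] D) (a : A) (b : B) :
    map f g (tmul a b) = tmul (f a) (g b) :=
  lift_tmul _ _ a b

variable [IsTopologicalAddGroup A] [IsTopologicalAddGroup B]

/-- The continuous linear map `b ↦ b ⊗ c` from `B` to `B ⊗̂ C`. -/
def mkRight (c : C) : B →L[ℂ] CTensor B C where
  toLinearMap := (mk B C).flip c
  cont := continuous_tmul.comp (continuous_id.prodMk continuous_const)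

/-- The bilinear map from `(A ⊗̂ B) × C` to `A ⊗̂ (B ⊗̂ C)` that sends `(a ⊗ b, c)` to
`a ⊗ (b ⊗ c)`. -/
def assocAux : CTensor A B →ₗ[ℂ] C →ₗ[ℂ] CTensor A (CTensor B C) :=
  LinearMap.flip
    { toFun := fun c ↦ (map (ContinuousLinearMap.id ℂ A) (mkRight c)).toLinearMap
      map_add' := fun c c' ↦ by
        rw [← ContinuousLinearMap.toLinearMap_add]
        congr 1
        refine ext fun a b ↦ ?_
        simp only [map_tmul, add_apply, ← tmul_add]
        congr 1
        exact tmul_add b c c'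
      map_smul' := fun k c ↦ by
        rw [RingHom.id_apply, ← ContinuousLinearMap.toLinearMap_smul]
        congr 1
        refine ext fun a b ↦ ?_
        simp only [map_tmul, smul_apply, ← tmul_smul]
        congr 1
        exact tmul_smul k b c }

theorem assocAux_tmul (a : A) (b : B) (c : C) :
    assocAux (tmul a b) c = tmul a (tmul b c) :=
  map_tmul _ _ a b

theorem continuous_assocAux [PolynormableSpace ℂ A] [PolynormableSpace ℂ B]
    [PolynormableSpace ℂ C] :
    Continuous fun x : CTensor A B × C ↦ assocAux x.1 x.2 := by
  refine continuous_bilinear_of_bound assocAux fun s hs ↦ ?_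
  obtain ⟨p, v, hp, hv, hpv⟩ := exists_seminorm_mul_bound
    (fun (a : A) (t : CTensor B C) ↦ s (tmul a t))
    (fun k a t ↦ by rw [smul_tmul, map_smul_eq_mul])
    (fun k a t ↦ by rw [tmul_smul, map_smul_eq_mul]) (hs.comp continuous_tmul)
  obtain ⟨q, r, hq, hr, hqr⟩ := exists_seminorm_mul_bound
    (fun (b : B) (c : C) ↦ v (tmul b c))
    (fun k a t ↦ by rw [smul_tmul, map_smul_eq_mul])
    (fun k a t ↦ by rw [tmul_smul, map_smul_eq_mul]) (hv.comp continuous_tmul)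
  have hπ : UniformContinuous (projSeminorm p q) :=
    Seminorm.uniformContinuous_of_continuousAt_zero (continuous_projSeminorm hp hq).continuousAt
  refine ⟨(projSeminorm p q).completion hπ, r, Seminorm.continuous_completion _ _, hr,
    fun t c ↦ ?_⟩
  induction t using Completion.induction_on with
  | hp =>
    exact isClosed_le (hs.comp (map (ContinuousLinearMap.id ℂ A) (mkRight c)).continuous)
      ((Seminorm.continuous_completion _ _).mul continuous_const)
  | ih u =>
    rw [Seminorm.completion_coe, mul_comm]
    refine le_mul_projSeminorm
      (r := s.comp ((map (ContinuousLinearMap.id ℂ A) (mkRight c)).comp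
        (ofTensor A B)).toLinearMap) (apply_nonneg r c) (fun a b ↦ ?_) u
    calc s (assocAux (tmul a b) c) = s (tmul a (tmul b c)) := by rw [assocAux_tmul]
      _ ≤ p a * v (tmul b c) := hpv _ _
      _ ≤ p a * (q b * r c) := mul_le_mul_of_nonneg_left (hqr b c) (apply_nonneg p a)
      _ = r c * (p a * q b) := by ring

/-- The canonical map `(A ⊗̂ B) ⊗̂ C → A ⊗̂ (B ⊗̂ C)`, `(a ⊗ b) ⊗ c ↦ a ⊗ (b ⊗ c)`. -/
def assoc [PolynormableSpace ℂ A] [PolynormableSpace ℂ B] [PolynormableSpace ℂ C] :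
    CTensor (CTensor A B) C →L[ℂ] CTensor A (CTensor B C) :=
  lift assocAux continuous_assocAux

theorem assoc_tmul [PolynormableSpace ℂ A] [PolynormableSpace ℂ B] [PolynormableSpace ℂ C]
    (a : A) (b : B) (c : C) :
    assoc (tmul (tmul a b) c) = tmul a (tmul b c) := by
  rw [assoc, lift_tmul, assocAux_tmul]

end CTensor

end Projective

/-! ## Completed projective tensor products of topological algebras -/

section Algebras

variable {A B : Type*} [Ring A] [Algebra ℂ A] [TopologicalSpace A] [IsTopologicalRing A]
  [PolynormableSpace ℂ A] [Ring B] [Algebra ℂ B] [TopologicalSpace B] [IsTopologicalRing B]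
  [PolynormableSpace ℂ B]

/-- The algebra `A ⊗ B`, with `(a ⊗ b) (a' ⊗ b') = a a' ⊗ b b'`, has a jointly continuous
multiplication for the projective topology. -/
instance TensorProduct.projectiveIsTopologicalRing : IsTopologicalRing (A ⊗[ℂ] B) := by
  have h : Continuous fun x : (A ⊗[ℂ] B) × (A ⊗[ℂ] B) ↦ LinearMap.mul ℂ (A ⊗[ℂ] B) x.1 x.2 := by
    refine continuous_bilinear_of_bound _ fun s hs ↦ ?_
    obtain ⟨p, q, hp, hq, hpq⟩ := exists_seminorm_mul_bound
      (fun (a : A) (b : B) ↦ s (a ⊗ₜ b))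
      (fun k a t ↦ by rw [← TensorProduct.smul_tmul', map_smul_eq_mul])
      (fun k a t ↦ by rw [TensorProduct.tmul_smul, map_smul_eq_mul]) (hs.comp continuous_projective_tmul)
    obtain ⟨p₁, p₂, hp₁, hp₂, hp'⟩ := exists_seminorm_mul_bound
      (fun (a a' : A) ↦ p (a * a'))
      (fun k a t ↦ by rw [smul_mul_assoc, map_smul_eq_mul])
      (fun k a t ↦ by rw [mul_smul_comm, map_smul_eq_mul]) (hp.comp continuous_mul)
    obtain ⟨q₁, q₂, hq₁, hq₂, hq'⟩ := exists_seminorm_mul_bound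
      (fun (a a' : B) ↦ q (a * a'))
      (fun k a t ↦ by rw [smul_mul_assoc, map_smul_eq_mul])
      (fun k a t ↦ by rw [mul_smul_comm, map_smul_eq_mul]) (hq.comp continuous_mul)
    refine ⟨projSeminorm p₁ q₁, projSeminorm p₂ q₂, continuous_projSeminorm hp₁ hq₁,
      continuous_projSeminorm hp₂ hq₂, fun u v ↦ ?_⟩
    refine le_mul_projSeminorm (r := s.comp (LinearMap.mulLeft ℂ u)) (apply_nonneg _ u)
      (fun c d ↦ ?_) v
    rw [mul_comm]
    refine le_mul_projSeminorm (r := s.comp (LinearMap.mulRight ℂ (c ⊗ₜ[ℂ] d)))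
      (mul_nonneg (apply_nonneg p₂ c) (apply_nonneg q₂ d)) (fun a b ↦ ?_) u
    calc s ((a ⊗ₜ b) * (c ⊗ₜ d)) = s ((a * c) ⊗ₜ (b * d)) := by
          rw [Algebra.TensorProduct.tmul_mul_tmul]
      _ ≤ p (a * c) * q (b * d) := hpq _ _
      _ ≤ (p₁ a * p₂ c) * (q₁ b * q₂ d) :=
          mul_le_mul (hp' a c) (hq' b d) (apply_nonneg q _)
            (mul_nonneg (apply_nonneg p₁ _) (apply_nonneg p₂ _))
      _ = p₂ c * q₂ d * (p₁ a * q₁ b) := by ring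
  have : ContinuousMul (A ⊗[ℂ] B) := ⟨h⟩
  have : ContinuousAdd (A ⊗[ℂ] B) := IsTopologicalAddGroup.toContinuousAdd
  have : ContinuousNeg (A ⊗[ℂ] B) := IsTopologicalAddGroup.toContinuousNeg
  exact {}

end Algebras

/-! ## Hopf algebras in the category of complete locally convex spaces -/

section Hopf

variable (A : Type*) [Ring A] [Algebra ℂ A] [UniformSpace A] [IsUniformAddGroup A]
  [IsTopologicalRing A] [UniformContinuousConstSMul ℂ A] [PolynormableSpace ℂ A]
  [CompleteSpace A] [T2Space A]

/-- The linearized multiplication `A ⊗̂ A → A`, `a ⊗ b ↦ a b`. -/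
def CTensor.mulMap : CTensor A A →L[ℂ] A :=
  CTensor.lift (LinearMap.mul ℂ A) continuous_mul

variable {A} in
/-- The map `f ⊗̂ 1 : A ⊗̂ A → ℂ ⊗̂ A = A`, `a ⊗ b ↦ f a • b`, for a continuous functional `f`. -/
def CTensor.evalLeft (f : A →L[ℂ] ℂ) : CTensor A A →L[ℂ] A :=
  CTensor.lift ((LinearMap.lsmul ℂ A).comp f.toLinearMap)
    (by
      have := (PolynormableSpace.withSeminorms ℂ A).continuousSMul
      exact (f.continuous.comp continuous_fst).smul continuous_snd)

variable {A} in
/-- The map `1 ⊗̂ f : A ⊗̂ A → A ⊗̂ ℂ = A`, `a ⊗ b ↦ f b • a`, for a continuous functional `f`. -/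
def CTensor.evalRight (f : A →L[ℂ] ℂ) : CTensor A A →L[ℂ] A :=
  CTensor.lift ((LinearMap.lsmul ℂ A).comp f.toLinearMap).flip
    (by
      have := (PolynormableSpace.withSeminorms ℂ A).continuousSMul
      exact (f.continuous.comp continuous_snd).smul continuous_fst)

/-- The structure of a Hopf `⊗̂`-algebra on a complete Hausdorff locally convex algebra `A` with
jointly continuous multiplication: `A ⊗̂ A` carries its multiplication as the completed
projective tensor product of algebras. -/
structure HopfCTensorAlgebra where
  /-- the comultiplication -/
  comul : A →A[ℂ] CTensor A A
  /-- the counit -/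
  counit : A →A[ℂ] ℂ
  /-- the antipode -/
  antipode : A →L[ℂ] A
  coassoc : ∀ a, CTensor.assoc (CTensor.map comul.toContinuousLinearMap
      (ContinuousLinearMap.id ℂ A) (comul a)) =
    CTensor.map (ContinuousLinearMap.id ℂ A) comul.toContinuousLinearMap (comul a)
  counit_left : ∀ a, CTensor.evalLeft counit.toContinuousLinearMap (comul a) = a
  counit_right : ∀ a, CTensor.evalRight counit.toContinuousLinearMap (comul a) = a
  antipode_left : ∀ a, CTensor.mulMap A (CTensor.map antipode (ContinuousLinearMap.id ℂ A)
    (comul a)) = algebraMap ℂ A (counit a)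
  antipode_right : ∀ a, CTensor.mulMap A (CTensor.map (ContinuousLinearMap.id ℂ A) antipode
    (comul a)) = algebraMap ℂ A (counit a)

end Hopf

/-! ## Free entire functions and holomorphically finitely generated algebras -/

section FreeEntire

/-- The family of all submultiplicative seminorms on the free algebra in `n` generators. -/
def freeSeminorms (n : ℕ) :
    {p : Seminorm ℂ (FreeAlgebra ℂ (Fin n)) // ∀ a b, p (a * b) ≤ p a * p b} →
      Seminorm ℂ (FreeAlgebra ℂ (Fin n)) :=
  fun p ↦ p.1

variable {n : ℕ}

/-- The free algebra carries the topology generated by all its submultiplicative seminorms. -/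
instance FreeAlgebra.envelopeUniformSpace : UniformSpace (FreeAlgebra ℂ (Fin n)) :=
  seminormUniformSpace (freeSeminorms n)

instance FreeAlgebra.envelopeIsUniformAddGroup : IsUniformAddGroup (FreeAlgebra ℂ (Fin n)) :=
  isUniformAddGroup_seminorm _

theorem withSeminorms_free : WithSeminorms (freeSeminorms n) :=
  withSeminorms_seminorm _

instance FreeAlgebra.envelopePolynormableSpace : PolynormableSpace ℂ (FreeAlgebra ℂ (Fin n)) :=
  withSeminorms_free.toPolynormableSpace

instance FreeAlgebra.envelopeContinuousSMul : ContinuousSMul ℂ (FreeAlgebra ℂ (Fin n)) :=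
  withSeminorms_free.continuousSMul

instance FreeAlgebra.envelopeUniformContinuousConstSMul :
    UniformContinuousConstSMul ℂ (FreeAlgebra ℂ (Fin n)) :=
  uniformContinuousConstSMul_of_continuousConstSMul _ _

instance FreeAlgebra.envelopeIsTopologicalRing : IsTopologicalRing (FreeAlgebra ℂ (Fin n)) := by
  have h : Continuous fun x : FreeAlgebra ℂ (Fin n) × FreeAlgebra ℂ (Fin n) ↦
      LinearMap.mul ℂ (FreeAlgebra ℂ (Fin n)) x.1 x.2 :=
    continuous_bilinear_of_seminorm withSeminorms_free _ fun p ↦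
      continuous_seminorm_bilinear_of_bound _ _ (withSeminorms_free.continuous_seminorm p)
        (withSeminorms_free.continuous_seminorm p) p.2
  have : ContinuousMul (FreeAlgebra ℂ (Fin n)) := ⟨h⟩
  have : ContinuousAdd (FreeAlgebra ℂ (Fin n)) := IsTopologicalAddGroup.toContinuousAdd
  have : ContinuousNeg (FreeAlgebra ℂ (Fin n)) := IsTopologicalAddGroup.toContinuousNeg
  exact {}

variable (n) in
/-- The algebra of free entire functions in `n` generators: the Arens–Michael envelope of the free
algebra, that is, its completion for the topology given by all submultiplicative seminorms. -/
abbrev FreeEntire : Type := Completion (FreeAlgebra ℂ (Fin n))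

/-- The generators of the algebra of free entire functions. -/
def FreeEntire.gen (i : Fin n) : FreeEntire n := (FreeAlgebra.ι ℂ i : FreeAlgebra ℂ (Fin n))

variable (n) in
/-- The largest submultiplicative seminorm bounded by `k` at `1` and at the generators. -/
def freeBound (k : ℕ) : Seminorm ℂ (FreeAlgebra ℂ (Fin n)) :=
  sSup {p | (∀ a b, p (a * b) ≤ p a * p b) ∧ p 1 ≤ k ∧ ∀ i, p (FreeAlgebra.ι ℂ i) ≤ k}

theorem bddAbove_freeBound (k : ℕ) :
    BddAbove {p : Seminorm ℂ (FreeAlgebra ℂ (Fin n)) |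
      (∀ a b, p (a * b) ≤ p a * p b) ∧ p 1 ≤ k ∧ ∀ i, p (FreeAlgebra.ι ℂ i) ≤ k} := by
  rw [Seminorm.bddAbove_iff]
  have h : ∀ u : FreeAlgebra ℂ (Fin n), ∃ M : ℝ, ∀ p : Seminorm ℂ (FreeAlgebra ℂ (Fin n)),
      ((∀ a b, p (a * b) ≤ p a * p b) ∧ p 1 ≤ k ∧ ∀ i, p (FreeAlgebra.ι ℂ i) ≤ k) →
        p u ≤ M := by
    intro u
    induction u using FreeAlgebra.induction with
    | grade0 r =>
      refine ⟨‖r‖ * k, fun p hp ↦ ?_⟩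
      rw [Algebra.algebraMap_eq_smul_one, map_smul_eq_mul]
      exact mul_le_mul_of_nonneg_left hp.2.1 (norm_nonneg r)
    | grade1 x => exact ⟨k, fun p hp ↦ hp.2.2 x⟩
    | mul u v hu hv =>
      obtain ⟨M, hM⟩ := hu
      obtain ⟨N, hN⟩ := hv
      exact ⟨M * N, fun p hp ↦ (hp.1 u v).trans (mul_le_mul (hM p hp) (hN p hp)
        (apply_nonneg p v) ((apply_nonneg p u).trans (hM p hp)))⟩
    | add u v hu hv =>
      obtain ⟨M, hM⟩ := hu
      obtain ⟨N, hN⟩ := hv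
      exact ⟨M + N, fun p hp ↦ (map_add_le_add p u v).trans (add_le_add (hM p hp) (hN p hp))⟩
  choose M hM using h
  refine ⟨M, ?_⟩
  rintro _ ⟨p, hp, rfl⟩ u
  exact hM u p hp

theorem freeBound_mul_le (k : ℕ) (a b : FreeAlgebra ℂ (Fin n)) :
    freeBound n k (a * b) ≤ freeBound n k a * freeBound n k b := by
  have : Nonempty {p : Seminorm ℂ (FreeAlgebra ℂ (Fin n)) |
      (∀ a b, p (a * b) ≤ p a * p b) ∧ p 1 ≤ k ∧ ∀ i, p (FreeAlgebra.ι ℂ i) ≤ k} :=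
    ⟨0, by simp⟩
  rw [freeBound, Seminorm.sSup_apply (bddAbove_freeBound k) (x := a * b)]
  refine ciSup_le fun p ↦ (p.2.1 a b).trans ?_
  have h := le_csSup (bddAbove_freeBound k) p.2
  exact mul_le_mul (h a) (h b) (apply_nonneg p.1 b) (apply_nonneg _ a)

instance FreeAlgebra.envelopeNhdsCountable :
    (𝓝 (0 : FreeAlgebra ℂ (Fin n))).IsCountablyGenerated := by
  have h := (SeminormFamily.withSeminorms_iff_nhds_eq_iInf (freeSeminorms n)).1 withSeminorms_free
  have h' : 𝓝 (0 : FreeAlgebra ℂ (Fin n)) = ⨅ k : ℕ, (𝓝 0).comap (freeBound n k) := by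
    refine le_antisymm (le_iInf fun k ↦ ?_) ?_
    · rw [h]
      exact iInf_le (fun p : {p : Seminorm ℂ (FreeAlgebra ℂ (Fin n)) //
          ∀ a b, p (a * b) ≤ p a * p b} ↦ Filter.comap (freeSeminorms n p) (𝓝 0))
        ⟨freeBound n k, freeBound_mul_le k⟩
    · rw [h]
      refine le_iInf fun p ↦ ?_
      obtain ⟨k, hk⟩ : ∃ k : ℕ, p.1 1 ≤ k ∧ ∀ i, p.1 (FreeAlgebra.ι ℂ i) ≤ k := by
        obtain ⟨M, hM⟩ := (Set.finite_range fun i ↦ p.1 (FreeAlgebra.ι ℂ i)).bddAbove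
        obtain ⟨k, hk⟩ := exists_nat_ge (max M (p.1 1))
        exact ⟨k, (le_max_right _ _).trans hk, fun i ↦
          (hM (Set.mem_range_self i)).trans ((le_max_left _ _).trans hk)⟩
      have hmem : p.1 ∈ {p : Seminorm ℂ (FreeAlgebra ℂ (Fin n)) |
          (∀ a b, p (a * b) ≤ p a * p b) ∧ p 1 ≤ k ∧ ∀ i, p (FreeAlgebra.ι ℂ i) ≤ k} :=
        ⟨p.2, hk⟩
      have hle : p.1 ≤ freeBound n k := le_csSup (bddAbove_freeBound k) hmem
      refine (iInf_le _ k).trans ?_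
      rw [← Filter.tendsto_iff_comap]
      exact squeeze_zero (fun x ↦ apply_nonneg p.1 x) hle Filter.tendsto_comap
  rw [h']
  exact Filter.iInf.isCountablyGenerated _

instance FreeEntire.firstCountableTopology : FirstCountableTopology (FreeEntire n) := by
  obtain ⟨s, hs⟩ := (𝓝 (0 : FreeAlgebra ℂ (Fin n))).exists_antitone_basis
  have h := hs.toHasBasis.hasBasis_of_isDenseInducing
    (Completion.isDenseInducing_coe (α := FreeAlgebra ℂ (Fin n)))
  rw [Completion.coe_zero] at h
  have : (𝓝 (0 : FreeEntire n)).IsCountablyGenerated := h.isCountablyGenerated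
  have : (uniformity (FreeEntire n)).IsCountablyGenerated :=
    IsUniformAddGroup.uniformity_countably_generated
  exact UniformSpace.firstCountableTopology _

end FreeEntire

section HFG

/-- An Arens–Michael algebra: a complete Hausdorff topological algebra whose topology is given by
a system of submultiplicative seminorms. -/
structure IsArensMichael (A : Type*) [Ring A] [Algebra ℂ A] [UniformSpace A] [IsUniformAddGroup A]
    [IsTopologicalRing A] [ContinuousSMul ℂ A] : Prop where
  complete : CompleteSpace A
  hausdorff : T2Space A
  exists_seminorm : ∀ U ∈ 𝓝 (0 : A), ∃ p : Seminorm ℂ A, Continuous p ∧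
    (∀ a b, p (a * b) ≤ p a * p b) ∧ {x | p x < 1} ⊆ U

/-- A holomorphically finitely generated (HFG) algebra: a Fréchet Arens–Michael algebra with
finitely many elements such that each `a ∈ A` is a free entire function of these elements. Here,
substituting elements `s₁, …, sₙ` of `A` into free entire functions is the continuous unital
homomorphism from the algebra of free entire functions to `A` that maps the generators
to `s₁, …, sₙ`. -/
structure IsHFG (A : Type*) [Ring A] [Algebra ℂ A] [UniformSpace A] [IsUniformAddGroup A]
    [IsTopologicalRing A] [ContinuousSMul ℂ A] : Prop where
  arensMichael : IsArensMichael A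
  firstCountable : FirstCountableTopology A
  generated : ∃ (n : ℕ) (φ : FreeEntire n →A[ℂ] A), Function.Surjective φ

end HFG

/-! ## The algebra `𝒪(Ãf₁)_q` -/

section AfTilde

/-- The closed two-sided ideal generated by a set. -/
def closedIdealSpan {R : Type*} [Ring R] [TopologicalSpace R] [IsTopologicalRing R] (s : Set R) :
    Ideal R :=
  (TwoSidedIdeal.span s).asIdeal.closure

instance closedIdealSpan.isTwoSided {R : Type*} [Ring R] [TopologicalSpace R] [IsTopologicalRing R]
    (s : Set R) : (closedIdealSpan s).IsTwoSided :=
  ⟨fun b ha ↦ map_mem_closure (f := fun x ↦ x * b) (continuous_mul_const b) ha fun _ hx ↦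
    Ideal.mul_mem_right b (TwoSidedIdeal.span s).asIdeal hx⟩

/-- The closed two-sided ideal of the algebra of free entire functions in two generators
`z = ζ₀` and `b = ζ₁` that is generated by `e^z b - q b e^z`. -/
def afIdeal (q : ℂ) : Ideal (FreeEntire 2) :=
  closedIdealSpan {NormedSpace.exp (FreeEntire.gen 0) * FreeEntire.gen 1 -
    q • (FreeEntire.gen 1 * NormedSpace.exp (FreeEntire.gen 0))}

instance afIdeal.isTwoSided (q : ℂ) : (afIdeal q).IsTwoSided :=
  closedIdealSpan.isTwoSided _

/-- The algebra `𝒪(Ãf₁)_q`: the quotient of the algebra of free entire functions in `z` and `b` by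
the closed two-sided ideal generated by `e^z b - q b e^z`, with the quotient topology. -/
def AfTilde (q : ℂ) : Type := FreeEntire 2 ⧸ afIdeal q

namespace AfTilde

variable (q : ℂ)

instance : Ring (AfTilde q) := inferInstanceAs (Ring (FreeEntire 2 ⧸ afIdeal q))
instance : Algebra ℂ (AfTilde q) := inferInstanceAs (Algebra ℂ (FreeEntire 2 ⧸ afIdeal q))

/-- The quotient homomorphism. -/
def proj : FreeEntire 2 →ₐ[ℂ] AfTilde q := Ideal.Quotient.mkₐ ℂ (afIdeal q)

theorem surjective_proj : Function.Surjective (proj q) :=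
  Ideal.Quotient.mk_surjective

instance : TopologicalSpace (AfTilde q) :=
  inferInstanceAs (TopologicalSpace (FreeEntire 2 ⧸ (afIdeal q).toAddSubgroup))

theorem isOpenQuotientMap_proj : IsOpenQuotientMap (proj q) :=
  QuotientAddGroup.isOpenQuotientMap_mk (N := (afIdeal q).toAddSubgroup)

theorem continuous_proj : Continuous (proj q) := (isOpenQuotientMap_proj q).continuous

instance : IsTopologicalAddGroup (AfTilde q) :=
  inferInstanceAs (IsTopologicalAddGroup (FreeEntire 2 ⧸ (afIdeal q).toAddSubgroup))

instance : IsTopologicalRing (AfTilde q) := by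
  have : ContinuousMul (AfTilde q) := ⟨by
    have h := (isOpenQuotientMap_proj q).prodMap (isOpenQuotientMap_proj q)
    rw [h.isQuotientMap.continuous_iff]
    have h2 : (fun x : AfTilde q × AfTilde q ↦ x.1 * x.2) ∘ Prod.map (proj q) (proj q) =
        fun x ↦ proj q (x.1 * x.2) := by
      ext x; simp
    rw [h2]
    exact (continuous_proj q).comp continuous_mul⟩
  exact {}

instance : UniformSpace (AfTilde q) := IsTopologicalAddGroup.rightUniformSpace (AfTilde q)

instance : IsUniformAddGroup (AfTilde q) := isUniformAddGroup_of_addCommGroup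

instance : CompleteSpace (AfTilde q) :=
  QuotientAddGroup.completeSpace_right (FreeEntire 2) (afIdeal q).toAddSubgroup

instance : T2Space (AfTilde q) := by
  have h : IsClosed ((afIdeal q).toAddSubgroup : Set (FreeEntire 2)) := isClosed_closure
  have : T3Space (FreeEntire 2 ⧸ (afIdeal q).toAddSubgroup) := inferInstance
  have : T3Space (AfTilde q) := this
  infer_instance

instance : ContinuousSMul ℂ (AfTilde q) := ⟨by
  have := (PolynormableSpace.withSeminorms ℂ (FreeEntire 2)).continuousSMul
  have h := (IsOpenQuotientMap.id (X := ℂ)).prodMap (isOpenQuotientMap_proj q)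
  rw [h.isQuotientMap.continuous_iff]
  have h2 : (fun x : ℂ × AfTilde q ↦ x.1 • x.2) ∘ Prod.map id (proj q) =
      fun x ↦ proj q (x.1 • x.2) := by
    ext x; simp
  rw [h2]
  exact (continuous_proj q).comp continuous_smul⟩

open scoped ComplexOrder in
instance : PolynormableSpace ℂ (AfTilde q) := by
  have := (PolynormableSpace.withSeminorms ℂ (FreeEntire 2)).toLocallyConvexSpace
  have hl : LocallyConvexSpace ℂ (AfTilde q) := by
    rw [locallyConvexSpace_iff_exists_convex_subset_zero]
    intro U hU
    obtain ⟨S, hS, hc, hSU⟩ :=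
      (locallyConvexSpace_iff_exists_convex_subset_zero ℝ (FreeEntire 2)).1 this (proj q ⁻¹' U)
        ((continuous_proj q).continuousAt.preimage_mem_nhds (by rwa [map_zero]))
    refine ⟨proj q '' S, ?_, convex_of_nonneg_surjective_algebraMap _
      (fun c hc ↦ by
        obtain ⟨x, hx, h⟩ := RCLike.nonneg_iff_exists_ofReal.mp (show (0 : ℂ) ≤ c from hc)
        exact ⟨x, hx, h⟩)
      (hc.linear_image ((proj q).toLinearMap.restrictScalars ℝ)), Set.image_subset_iff.2 hSU⟩
    have h := (isOpenQuotientMap_proj q).isOpenMap.image_mem_nhds hS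
    rwa [map_zero] at h
  have : ContinuousSMul ℝ (AfTilde q) := IsScalarTower.continuousSMul ℂ
  exact LocallyConvexSpace.toPolynormableSpace

instance : UniformContinuousConstSMul ℂ (AfTilde q) :=
  uniformContinuousConstSMul_of_continuousConstSMul _ _

/-- The generator `z`. -/
def z : AfTilde q := proj q (FreeEntire.gen 0)

/-- The generator `b`. -/
def b : AfTilde q := proj q (FreeEntire.gen 1)

end AfTilde

/-- `A`, with distinguished elements `z` and `b`, is the universal HFG algebra generated by `z` and
`b` subject to the relation `e^z b = q b e^z`: it is an HFG algebra, `z` and `b` satisfy the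
relation and generate it topologically, and any two elements of an HFG algebra that satisfy the
relation are the images of `z` and `b` under a unique continuous unital homomorphism. -/
structure IsUniversalAf (q : ℂ) (A : Type) [Ring A] [Algebra ℂ A] [UniformSpace A]
    [IsUniformAddGroup A] [IsTopologicalRing A] [ContinuousSMul ℂ A] (z b : A) : Prop where
  isHFG : IsHFG A
  generates : (Algebra.adjoin ℂ {z, b}).topologicalClosure = ⊤
  relation : NormedSpace.exp z * b = q • (b * NormedSpace.exp z)
  existsUnique_hom : ∀ (B : Type u) [Ring B] [Algebra ℂ B] [UniformSpace B] [IsUniformAddGroup B]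
    [IsTopologicalRing B] [ContinuousSMul ℂ B], IsHFG B → ∀ x y : B,
    NormedSpace.exp x * y = q • (y * NormedSpace.exp x) →
      ∃! φ : A →A[ℂ] B, φ z = x ∧ φ b = y

/-- The formulas for the comultiplication, the counit and the antipode on the generators, together
with antimultiplicativity of the antipode. -/
structure HasAfFormulas {q : ℂ} (H : HopfCTensorAlgebra (AfTilde q)) : Prop where
  comul_z : H.comul (AfTilde.z q) =
    CTensor.tmul 1 (AfTilde.z q) + CTensor.tmul (AfTilde.z q) 1
  comul_b : H.comul (AfTilde.b q) =
    CTensor.tmul (NormedSpace.exp (AfTilde.z q)) (AfTilde.b q) + CTensor.tmul (AfTilde.b q) 1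
  counit_z : H.counit (AfTilde.z q) = 0
  counit_b : H.counit (AfTilde.b q) = 0
  antipode_mul : ∀ x y, H.antipode (x * y) = H.antipode y * H.antipode x
  antipode_one : H.antipode 1 = 1
  antipode_z : H.antipode (AfTilde.z q) = -AfTilde.z q
  antipode_b : H.antipode (AfTilde.b q) = -(NormedSpace.exp (-AfTilde.z q) * AfTilde.b q)

end AfTilde

end

/-!
The topology of an Arens–Michael algebra `A` is given by submultiplicative seminorms, so `A` maps
to the Banach algebras obtained by completing it for each of them, and these maps separate points.
Hence exponentials exist in `A`, are preserved by continuous homomorphisms, and satisfy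
`e^(x + y) = e^x e^y` for commuting `x` and `y` (`IsArensMichael.exp_add_of_commute`).

The algebra of free entire functions, the algebra `𝒪(Ãf₁)_q`, the completed tensor product of two
Arens–Michael algebras and the opposite of one are again Arens–Michael. Substitution of elements of
an Arens–Michael algebra `B` into free entire functions is continuous, because the composition of a
submultiplicative seminorm with a homomorphism is submultiplicative; it kills the closed ideal
generated by the relation when the two elements satisfy it. So `𝒪(Ãf₁)_q` is universal with respect
to all Arens–Michael algebras `B` (`AfTilde.lift`), in particular the HFG ones. Evaluating at
`z = c`, `b = 0` for all complex numbers `c` shows that `z` is not algebraic, so the algebra is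
infinite-dimensional.

The comultiplication exists by the universal property: `e^(1 ⊗ z + z ⊗ 1) = e^z ⊗ e^z`, and this
element satisfies the relation with `e^z ⊗ b + b ⊗ 1`. The antipode is a homomorphism to the
opposite algebra, and so is its inverse `z ↦ -z`, `b ↦ -b e^{-z}`. Coassociativity and the counit
      axioms are
equalities of continuous homomorphisms and are checked on `z` and `b`. The antipode axioms are not
of this form. Instead, `F = m ∘ (S ⊗̂ 1)` satisfies `F(t (x ⊗ y)) = S(x) F(t) y`, so that
`F(Δ(a)) = ε(a) 1` implies `F(Δ(a) u) = ε(a) F(u)` for all `u`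
(`IsArensMichaelUniversal.antipodeMul_mul`). Hence the elements `a` with `F(Δ(a)) = ε(a) 1` form a
closed subalgebra, and this subalgebra contains `z` and `b`.
-/

noncomputable section

/-! ### Exponentials in Arens–Michael algebras -/

section ArensMichael

variable {A : Type*} [Ring A] [Algebra ℂ A]

theorem Seminorm.map_pow_le_of_submultiplicative {p : Seminorm ℂ A}
    (hp : ∀ a b, p (a * b) ≤ p a * p b) (x : A) (n : ℕ) : p (x ^ n) ≤ p 1 * p x ^ n := by
  induction n with
  | zero => simp
  | succ n ih =>
    rw [pow_succ, pow_succ, ← mul_assoc]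
    exact (hp _ _).trans (mul_le_mul_of_nonneg_right ih (apply_nonneg p x))

theorem Seminorm.le_of_forall_lt_one {E : Type*} [AddCommGroup E] [Module ℂ E]
    {p r : Seminorm ℂ E} (h : ∀ x, p x < 1 → r x < 1) : r ≤ p := by
  intro x
  refine le_of_forall_pos_le_add fun ε hε ↦ ?_
  have hp : 0 < p x + ε := add_pos_of_nonneg_of_pos (apply_nonneg p x) hε
  have hn (s : Seminorm ℂ E) : s (((p x + ε : ℝ) : ℂ)⁻¹ • x) = (p x + ε)⁻¹ * s x := by
    rw [map_smul_eq_mul, norm_inv, Complex.norm_real, Real.norm_eq_abs, abs_of_pos hp]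
  have h1 := h (((p x + ε : ℝ) : ℂ)⁻¹ • x) (by
    rw [hn, inv_mul_lt_iff₀ hp]; linarith)
  rw [hn, inv_mul_lt_iff₀ hp] at h1
  linarith

variable [UniformSpace A] [IsUniformAddGroup A] [IsTopologicalRing A] [ContinuousSMul ℂ A]

namespace IsArensMichael

/-- The continuous submultiplicative seminorms separate points. -/
theorem eq_of_seminorm_sub_eq_zero (hA : IsArensMichael A) {x y : A}
    (h : ∀ p : Seminorm ℂ A, Continuous p → (∀ a b, p (a * b) ≤ p a * p b) → p (x - y) = 0) :
    x = y := by
  have := hA.hausdorff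
  by_contra hne
  have hU : ({x - y}ᶜ : Set A) ∈ 𝓝 0 :=
    isOpen_compl_singleton.mem_nhds fun h0 ↦ hne (sub_eq_zero.1 (Set.mem_singleton_iff.1 h0).symm)
  obtain ⟨p, hp, hm, hpU⟩ := hA.exists_seminorm _ hU
  exact hpU (show p (x - y) < 1 by rw [h p hp hm]; exact one_pos) rfl

theorem summable_exp (hA : IsArensMichael A) (x : A) :
    Summable fun n : ℕ ↦ ((n.factorial : ℂ)⁻¹) • x ^ n := by
  have := hA.complete
  rw [summable_iff_vanishing]
  intro U hU
  obtain ⟨p, -, hm, hpU⟩ := hA.exists_seminorm U hU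
  have hs : Summable fun n : ℕ ↦ p 1 * (p x ^ n / n.factorial) :=
    (Real.summable_pow_div_factorial (p x)).mul_left _
  obtain ⟨s, hs⟩ := summable_iff_vanishing.1 hs (Set.Iio 1) (Iio_mem_nhds one_pos)
  refine ⟨s, fun t ht ↦ hpU (show p _ < 1 from lt_of_le_of_lt ?_ (hs t ht))⟩
  refine (Finset.le_sum_of_subadditive p (map_zero p).le (map_add_le_add p) t _).trans
    (Finset.sum_le_sum fun n _ ↦ ?_)
  rw [map_smul_eq_mul, norm_inv, Complex.norm_natCast, inv_mul_eq_div, mul_div_assoc']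
  gcongr
  exact Seminorm.map_pow_le_of_submultiplicative hm x n

end IsArensMichael

theorem ContinuousAlgHom.map_exp {B : Type*} [Ring B] [Algebra ℂ B] [TopologicalSpace B]
    [IsTopologicalRing B] [T2Space B] (hA : IsArensMichael A) (f : A →A[ℂ] B) (x : A) :
    f (NormedSpace.exp x) = NormedSpace.exp (f x) := by
  rw [NormedSpace.exp_eq_tsum ℂ, NormedSpace.exp_eq_tsum ℂ]
  refine ((hA.summable_exp x).map_tsum f f.continuous).trans ?_
  simp

end ArensMichael

section Exponential

variable {A : Type*} [Ring A] [Algebra ℂ A]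

/-- The algebra `A`, seen as a seminormed algebra whose seminorm is the submultiplicative
seminorm `p`. -/
def SeminormedBy (_p : {p : Seminorm ℂ A // ∀ a b, p (a * b) ≤ p a * p b}) : Type _ := A

namespace SeminormedBy

variable (p : {p : Seminorm ℂ A // ∀ a b, p (a * b) ≤ p a * p b})

instance : Ring (SeminormedBy p) := inferInstanceAs (Ring A)

instance : Algebra ℂ (SeminormedBy p) := inferInstanceAs (Algebra ℂ A)

instance : SeminormedRing (SeminormedBy p) :=
  { (inferInstance : Ring (SeminormedBy p)),
    (p.1.toSeminormedAddCommGroup : SeminormedAddCommGroup (SeminormedBy p)) with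
    norm_mul_le := p.2 }

instance : NormedAlgebra ℂ (SeminormedBy p) :=
  { (inferInstance : Algebra ℂ (SeminormedBy p)) with
    norm_smul_le := fun c x ↦ (map_smul_eq_mul p.1 c x).le }

instance : UniformContinuousConstSMul ℂ (SeminormedBy p) :=
  uniformContinuousConstSMul_of_continuousConstSMul _ _

instance : NormedAlgebra ℂ (Completion (SeminormedBy p)) where
  norm_smul_le := norm_smul_le

variable [TopologicalSpace A] [IsTopologicalAddGroup A]

/-- The canonical homomorphism from a topological algebra to the Banach algebra given by one of
its continuous submultiplicative seminorms. -/
def toBanach (hp : Continuous p.1) : A →A[ℂ] Completion (SeminormedBy p) where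
  toFun a := (show SeminormedBy p from a)
  map_one' := Completion.coe_one _
  map_mul' a b := Completion.coe_mul (α := SeminormedBy p) a b
  map_zero' := Completion.coe_zero
  map_add' a b := Completion.coe_add (α := SeminormedBy p) a b
  commutes' c := rfl
  cont := by
    refine continuous_of_continuousAt_zero
      (AddMonoidHom.mk' (fun a : A ↦ ((show SeminormedBy p from a) : Completion (SeminormedBy p)))
        fun a b ↦ Completion.coe_add (α := SeminormedBy p) a b) ?_
    rw [ContinuousAt, map_zero, tendsto_zero_iff_norm_tendsto_zero]
    have h := hp.tendsto 0
    rw [map_zero] at h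
    exact h.congr fun a ↦ (Completion.norm_coe (E := SeminormedBy p) a).symm

theorem norm_toBanach (hp : Continuous p.1) (a : A) : ‖toBanach p hp a‖ = p.1 a :=
  Completion.norm_coe (E := SeminormedBy p) a

end SeminormedBy

variable [UniformSpace A] [IsUniformAddGroup A] [IsTopologicalRing A] [ContinuousSMul ℂ A]

namespace IsArensMichael

theorem exp_add_of_commute (hA : IsArensMichael A) {x y : A} (hxy : Commute x y) :
    NormedSpace.exp (x + y) = NormedSpace.exp x * NormedSpace.exp y := by
  refine hA.eq_of_seminorm_sub_eq_zero fun p hp hm ↦ ?_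
  let f := SeminormedBy.toBanach ⟨p, hm⟩ hp
  let _ : NormedAlgebra ℚ (Completion (SeminormedBy (⟨p, hm⟩ :
    {p : Seminorm ℂ A // ∀ a b, p (a * b) ≤ p a * p b}))) := NormedAlgebra.restrictScalars ℚ ℂ _
  refine (SeminormedBy.norm_toBanach ⟨p, hm⟩ hp _).symm.trans ?_
  change ‖f _‖ = 0
  rw [norm_eq_zero, map_sub, map_mul, f.map_exp hA, f.map_exp hA, f.map_exp hA, map_add,
    NormedSpace.exp_add_of_commute (hxy.map f), sub_self]

theorem exp_neg_mul_exp (hA : IsArensMichael A) (x : A) :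
    NormedSpace.exp (-x) * NormedSpace.exp x = 1 := by
  rw [← hA.exp_add_of_commute (Commute.refl x).neg_left, neg_add_cancel, NormedSpace.exp_zero]

theorem exp_mul_exp_neg (hA : IsArensMichael A) (x : A) :
    NormedSpace.exp x * NormedSpace.exp (-x) = 1 := by
  simpa using hA.exp_neg_mul_exp (-x)

end IsArensMichael

end Exponential

/-! ### Constructions of Arens–Michael algebras -/

section Examples

instance Completion.continuousSMul {E : Type*} [AddCommGroup E] [Module ℂ E] [UniformSpace E]
    [IsUniformAddGroup E] [UniformContinuousConstSMul ℂ E] [PolynormableSpace ℂ E] :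
    ContinuousSMul ℂ (Completion E) :=
  (PolynormableSpace.withSeminorms ℂ (Completion E)).continuousSMul

section Complete

variable {R : Type*} [Ring R] [Algebra ℂ R] [UniformSpace R] [IsUniformAddGroup R]
  [IsTopologicalRing R] [UniformContinuousConstSMul ℂ R]

/-- The completion of an algebra whose topology is given by submultiplicative seminorms is an
Arens–Michael algebra. -/
theorem IsArensMichael.completion [ContinuousSMul ℂ (Completion R)]
    (h : ∀ U ∈ 𝓝 (0 : R), ∃ p : Seminorm ℂ R, Continuous p ∧
      (∀ a b, p (a * b) ≤ p a * p b) ∧ {x | p x < 1} ⊆ U) : IsArensMichael (Completion R) where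
  complete := inferInstance
  hausdorff := inferInstance
  exists_seminorm U hU := by
    have : PolynormableSpace ℂ R := polynormableSpace_of_balls fun U hU ↦
      let ⟨p, hp, _, h⟩ := h U hU
      ⟨p, hp, h⟩
    obtain ⟨r, hr, hrU⟩ := exists_seminorm_ball_subset hU
    have h1 : {x : R | r x < 1} ∈ 𝓝 (0 : R) :=
      (isOpen_lt (hr.comp (Completion.continuous_coe R)) continuous_const).mem_nhds (by
        simp [Completion.coe_zero])
    obtain ⟨p, hp, hm, hpr⟩ := h _ h1
    have hu : UniformContinuous p :=
      Seminorm.uniformContinuous_of_continuousAt_zero hp.continuousAt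
    have hc := p.continuous_completion hu
    refine ⟨p.completion hu, hc, fun a b ↦ ?_, fun x hx ↦ hrU ?_⟩
    · refine Completion.induction_on₂ a b (isClosed_le (hc.comp continuous_mul)
        ((hc.comp continuous_fst).mul (hc.comp continuous_snd))) fun a b ↦ ?_
      rw [← Completion.coe_mul, Seminorm.completion_coe, Seminorm.completion_coe,
        Seminorm.completion_coe]
      exact hm a b
    -- On the dense image of `R`, the bound holds by homogeneity; it extends by continuity.
    · have hle : r x ≤ p.completion hu x := by
        refine Completion.induction_on x (isClosed_le hr hc) fun a ↦ ?_
        rw [Seminorm.completion_coe]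
        exact Seminorm.le_of_forall_lt_one (p := p)
          (r := r.comp (⟨⟨((↑) : R → Completion R), Completion.coe_add⟩, Completion.coe_smul⟩ :
            R →ₗ[ℂ] Completion R)) (fun x hx ↦ hpr hx) a
      exact lt_of_le_of_lt hle hx

end Complete

/-- A ball of a submultiplicative seminorm contains the unit ball of a submultiplicative seminorm,
namely of a multiple of it by a constant that is at least `1`. -/
theorem Seminorm.exists_submultiplicative_ball_subset {R : Type*} [Ring R] [Algebra ℂ R]
    [TopologicalSpace R] {p : Seminorm ℂ R} (hc : Continuous p)
    (hm : ∀ a b, p (a * b) ≤ p a * p b) {r : ℝ} (hr : 0 < r) :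
    ∃ p' : Seminorm ℂ R, Continuous p' ∧ (∀ a b, p' (a * b) ≤ p' a * p' b) ∧
      {x | p' x < 1} ⊆ p.ball 0 r := by
  obtain ⟨K, hK1, hKr⟩ : ∃ K : NNReal, (1 : ℝ) ≤ K ∧ r⁻¹ ≤ K :=
    ⟨(max 1 r⁻¹).toNNReal, (le_max_left 1 _).trans (Real.le_coe_toNNReal _),
      (le_max_right 1 _).trans (Real.le_coe_toNNReal _)⟩
  refine ⟨K • p, continuous_const.mul hc, fun a b ↦ ?_, fun x hx ↦ ?_⟩
  · calc (K : ℝ) * p (a * b) ≤ K * (p a * p b) := by gcongr; exact hm a b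
      _ ≤ K * (K * (p a * p b)) := by
        refine mul_le_mul_of_nonneg_left ?_ K.2
        exact le_mul_of_one_le_left (mul_nonneg (apply_nonneg p a) (apply_nonneg p b)) hK1
      _ = K * p a * (K * p b) := by ring
  · have h : (K : ℝ) * p x < 1 := hx
    rw [Seminorm.mem_ball_zero, ← mul_one r, ← inv_mul_lt_iff₀ hr]
    exact (mul_le_mul_of_nonneg_right hKr (apply_nonneg p x)).trans_lt h

theorem FreeEntire.isArensMichael (n : ℕ) :
    IsArensMichael (FreeEntire n) := by
  refine IsArensMichael.completion fun U hU ↦ ?_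
  obtain ⟨s, r, hr, hs⟩ := (withSeminorms_free.mem_nhds_iff 0 U).1 hU
  have hc := Seminorm.continuous_finsetSup (p := freeSeminorms n) (s := s)
    (fun i _ ↦ withSeminorms_free.continuous_seminorm i)
  set p := s.sup (freeSeminorms n) with hp
  have hm : ∀ a b, p (a * b) ≤ p a * p b := fun a b ↦ by
    refine Seminorm.finset_sup_apply_le (mul_nonneg (apply_nonneg p a) (apply_nonneg p b))
      fun i hi ↦ (i.2 a b).trans ?_
    exact mul_le_mul (Seminorm.le_finset_sup_apply hi) (Seminorm.le_finset_sup_apply hi)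
      (apply_nonneg _ _) (apply_nonneg _ _)
  obtain ⟨p', hp', hm', hr'⟩ := Seminorm.exists_submultiplicative_ball_subset hc hm hr
  exact ⟨p', hp', hm', hr'.trans hs⟩

theorem isArensMichael_complex : IsArensMichael ℂ where
  complete := inferInstance
  hausdorff := inferInstance
  exists_seminorm U hU := by
    obtain ⟨r, hr, hrU⟩ := Metric.mem_nhds_iff.1 hU
    rw [← ball_normSeminorm ℂ ℂ] at hrU
    obtain ⟨p', hp', hm', hr'⟩ := Seminorm.exists_submultiplicative_ball_subset
      (p := normSeminorm ℂ ℂ) continuous_norm norm_mul_le hr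
    exact ⟨p', hp', hm', hr'.trans hrU⟩

section Tensor

variable {A B : Type*} [Ring A] [Algebra ℂ A] [Ring B] [Algebra ℂ B]

/-- The projective tensor product of submultiplicative seminorms is submultiplicative. -/
theorem projSeminorm_mul_le {p : Seminorm ℂ A} {q : Seminorm ℂ B}
    (hp : ∀ a b, p (a * b) ≤ p a * p b) (hq : ∀ a b, q (a * b) ≤ q a * q b) (u v : A ⊗[ℂ] B) :
    projSeminorm p q (u * v) ≤ projSeminorm p q u * projSeminorm p q v := by
  refine le_mul_projSeminorm (r := (projSeminorm p q).comp (LinearMap.mulLeft ℂ u))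
    (apply_nonneg _ u) (fun c d ↦ ?_) v
  rw [mul_comm]
  refine le_mul_projSeminorm (r := (projSeminorm p q).comp (LinearMap.mulRight ℂ (c ⊗ₜ[ℂ] d)))
    (mul_nonneg (apply_nonneg p c) (apply_nonneg q d)) (fun a b ↦ ?_) u
  calc projSeminorm p q ((a ⊗ₜ b) * (c ⊗ₜ d)) = projSeminorm p q ((a * c) ⊗ₜ (b * d)) := by
        rw [Algebra.TensorProduct.tmul_mul_tmul]
    _ ≤ p (a * c) * q (b * d) := projSeminorm_tmul_le p q _ _
    _ ≤ (p a * p c) * (q b * q d) :=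
        mul_le_mul (hp a c) (hq b d) (apply_nonneg q _)
          (mul_nonneg (apply_nonneg p _) (apply_nonneg p _))
    _ = p c * q d * (p a * q b) := by ring

variable [UniformSpace A] [IsUniformAddGroup A] [IsTopologicalRing A] [ContinuousSMul ℂ A]
  [PolynormableSpace ℂ A]
  [UniformSpace B] [IsUniformAddGroup B] [IsTopologicalRing B] [ContinuousSMul ℂ B]
  [PolynormableSpace ℂ B]

/-- The completed projective tensor product of Arens–Michael algebras is an Arens–Michael
algebra. -/
theorem CTensor.isArensMichael (hA : IsArensMichael A) (hB : IsArensMichael B) :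
    IsArensMichael (CTensor A B) := by
  refine IsArensMichael.completion fun U hU ↦ ?_
  obtain ⟨s, hs, hsU⟩ := exists_seminorm_ball_subset hU
  obtain ⟨p, q, hp, hq, hpq⟩ := exists_seminorm_mul_bound
    (fun (a : A) (b : B) ↦ s (a ⊗ₜ b))
    (fun k a t ↦ by rw [← TensorProduct.smul_tmul', map_smul_eq_mul])
    (fun k a t ↦ by rw [TensorProduct.tmul_smul, map_smul_eq_mul])
    (hs.comp continuous_projective_tmul)
  obtain ⟨p', hp', hpm, hpU⟩ := hA.exists_seminorm {x | p x < 1}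
    ((isOpen_lt hp continuous_const).mem_nhds (by simp))
  obtain ⟨q', hq', hqm, hqU⟩ := hB.exists_seminorm {x | q x < 1}
    ((isOpen_lt hq continuous_const).mem_nhds (by simp))
  refine ⟨projSeminorm p' q', continuous_projSeminorm hp' hq', projSeminorm_mul_le hpm hqm,
    fun x hx ↦ hsU (lt_of_le_of_lt (b := projSeminorm p' q' x)
      (le_projSeminorm (fun a b ↦ (hpq a b).trans ?_) x) hx)⟩
  exact mul_le_mul (Seminorm.le_of_forall_lt_one (fun _ h ↦ hpU h) a)
    (Seminorm.le_of_forall_lt_one (fun _ h ↦ hqU h) b) (apply_nonneg q b) (apply_nonneg p' a)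

end Tensor

section Quotient

variable {A Q : Type*} [Ring A] [Algebra ℂ A] [UniformSpace A] [IsUniformAddGroup A]
  [IsTopologicalRing A] [ContinuousSMul ℂ A] [Ring Q] [Algebra ℂ Q] [UniformSpace Q]
  [IsUniformAddGroup Q] [IsTopologicalRing Q] [ContinuousSMul ℂ Q]

/-- The quotient seminorm `y ↦ inf {p x | f x = y}` of a seminorm `p` under a surjection `f`. -/
def Seminorm.quotient {E F : Type*} [AddCommGroup E] [Module ℂ E] [AddCommGroup F] [Module ℂ F]
    (p : Seminorm ℂ E) (f : E →ₗ[ℂ] F) (hf : Function.Surjective f) : Seminorm ℂ F :=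
  have hbdd (y : F) : BddBelow (Set.range fun x : {x // f x = y} ↦ p x) :=
    ⟨0, by rintro _ ⟨x, rfl⟩; exact apply_nonneg p _⟩
  have hne (y : F) : Nonempty {x // f x = y} := let ⟨x, hx⟩ := hf y; ⟨⟨x, hx⟩⟩
  Seminorm.ofSMulLE (fun y ↦ ⨅ x : {x // f x = y}, p x)
    (le_antisymm ((ciInf_le (hbdd 0) ⟨0, map_zero f⟩).trans (map_zero p).le)
      (le_ciInf fun x ↦ apply_nonneg p _))
    (fun y y' ↦ le_ciInf_add_ciInf fun x x' ↦ (ciInf_le (hbdd (y + y')) ⟨x + x', by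
      rw [map_add, x.2, x'.2]⟩).trans (map_add_le_add p _ _))
    (fun c y ↦ by
      rw [Real.mul_iInf_of_nonneg (norm_nonneg c)]
      exact le_ciInf fun x ↦ (ciInf_le (hbdd (c • y)) ⟨c • x, by rw [map_smul, x.2]⟩).trans
        (map_smul_eq_mul p _ _).le)

theorem Seminorm.quotient_apply_le {E F : Type*} [AddCommGroup E] [Module ℂ E] [AddCommGroup F]
    [Module ℂ F] (p : Seminorm ℂ E) (f : E →ₗ[ℂ] F) (hf : Function.Surjective f) (x : E) :
    p.quotient f hf (f x) ≤ p x :=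
  ciInf_le (f := fun x' : {x' // f x' = f x} ↦ p x')
    ⟨0, by rintro _ ⟨x, rfl⟩; exact apply_nonneg p _⟩ ⟨x, rfl⟩

theorem Seminorm.exists_lt_of_quotient_lt {E F : Type*} [AddCommGroup E] [Module ℂ E]
    [AddCommGroup F] [Module ℂ F] (p : Seminorm ℂ E) (f : E →ₗ[ℂ] F) (hf : Function.Surjective f)
    {y : F} {c : ℝ} (h : p.quotient f hf y < c) : ∃ x, f x = y ∧ p x < c := by
  have : Nonempty {x // f x = y} := let ⟨x, hx⟩ := hf y; ⟨⟨x, hx⟩⟩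
  obtain ⟨x, hx⟩ := exists_lt_of_ciInf_lt (f := fun x : {x // f x = y} ↦ p x) h
  exact ⟨x, x.2, hx⟩

/-- A complete Hausdorff quotient of an Arens–Michael algebra is an Arens–Michael algebra. -/
theorem IsArensMichael.of_isOpenQuotientMap (hA : IsArensMichael A) [CompleteSpace Q] [T2Space Q]
    (f : A →ₐ[ℂ] Q) (hf : IsOpenQuotientMap f) : IsArensMichael Q where
  complete := inferInstance
  hausdorff := inferInstance
  exists_seminorm U hU := by
    obtain ⟨p, hp, hm, hpU⟩ := hA.exists_seminorm (f ⁻¹' U)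
      (hf.continuous.continuousAt.preimage_mem_nhds (by rwa [map_zero]))
    set r := p.quotient f.toLinearMap hf.surjective with hr
    refine ⟨r, ?_, fun y y' ↦ ?_, fun y hy ↦ ?_⟩
    · refine Seminorm.continuous' (r := 1) ?_
      refine Filter.mem_of_superset (x := f '' {x | p x < 1}) ?_ ?_
      · have h := hf.isOpenMap.image_mem_nhds (x := 0) (s := {x | p x < 1})
          ((isOpen_lt hp continuous_const).mem_nhds (by simp))
        rwa [map_zero] at h
      · rintro _ ⟨x, hx, rfl⟩
        rw [Seminorm.mem_closedBall_zero]
        exact (p.quotient_apply_le f.toLinearMap hf.surjective x).trans (le_of_lt hx)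
    · have key : ∀ ε > (0 : ℝ), r (y * y') ≤ (r y + ε) * (r y' + ε) := by
        intro ε hε
        obtain ⟨x, hx, hxε⟩ := p.exists_lt_of_quotient_lt f.toLinearMap hf.surjective
          (lt_add_of_pos_right (r y) hε)
        obtain ⟨x', hx', hxε'⟩ := p.exists_lt_of_quotient_lt f.toLinearMap hf.surjective
          (lt_add_of_pos_right (r y') hε)
        have h1 : f.toLinearMap (x * x') = y * y' := by
          rw [← hx, ← hx']; exact map_mul f x x'
        rw [← h1]
        exact (p.quotient_apply_le f.toLinearMap hf.surjective _).trans ((hm x x').trans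
          (mul_le_mul hxε.le hxε'.le (apply_nonneg p _) ((apply_nonneg p x).trans hxε.le)))
      have hlim : Filter.Tendsto (fun ε : ℝ ↦ (r y + ε) * (r y' + ε)) (𝓝[>] 0)
          (𝓝 ((r y + 0) * (r y' + 0))) :=
        Filter.Tendsto.mono_left (Continuous.tendsto (by fun_prop) 0) nhdsWithin_le_nhds
      simp only [add_zero] at hlim
      exact ge_of_tendsto hlim (eventually_nhdsWithin_of_forall key)
    · obtain ⟨x, rfl, hx⟩ := p.exists_lt_of_quotient_lt f.toLinearMap hf.surjective hy
      exact hpU hx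

instance MulOpposite.isUniformAddGroup {G : Type*} [UniformSpace G] [AddGroup G]
    [IsUniformAddGroup G] : IsUniformAddGroup Gᵐᵒᵖ :=
  ⟨MulOpposite.uniformContinuous_op.comp
    ((MulOpposite.uniformContinuous_unop.comp uniformContinuous_fst).sub
      (MulOpposite.uniformContinuous_unop.comp uniformContinuous_snd))⟩

theorem IsArensMichael.mulOpposite (hA : IsArensMichael A) : IsArensMichael Aᵐᵒᵖ where
  complete := have := hA.complete; inferInstance
  hausdorff := have := hA.hausdorff; inferInstance
  exists_seminorm U hU := by
    obtain ⟨p, hp, hm, hpU⟩ := hA.exists_seminorm (MulOpposite.op ⁻¹' U)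
      (MulOpposite.continuous_op.continuousAt.preimage_mem_nhds (by rwa [MulOpposite.op_zero]))
    refine ⟨p.comp (MulOpposite.opLinearEquiv ℂ).symm.toLinearMap,
      hp.comp MulOpposite.continuous_unop, fun a b ↦ ?_, fun x hx ↦ hpU hx⟩
    exact (hm b.unop a.unop).trans (mul_comm _ _).le

end Quotient

end Examples

/-! ### Substitution into free entire functions and the universal property of `𝒪(Ãf₁)_q` -/

section UniversalProperty

variable {B : Type*} [Ring B] [Algebra ℂ B] [UniformSpace B] [IsUniformAddGroup B]
  [IsTopologicalRing B] [ContinuousSMul ℂ B]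

namespace FreeEntire

variable {n : ℕ}

theorem continuous_freeAlgebraLift (hB : IsArensMichael B) (s : Fin n → B) :
    Continuous (FreeAlgebra.lift ℂ s) := by
  refine continuous_of_continuousAt_zero (FreeAlgebra.lift ℂ s) ?_
  rw [ContinuousAt, map_zero]
  intro U hU
  obtain ⟨p, hp, hm, hpU⟩ := hB.exists_seminorm U hU
  have hc : Continuous (p.comp (FreeAlgebra.lift ℂ s).toLinearMap) :=
    withSeminorms_free.continuous_seminorm ⟨p.comp (FreeAlgebra.lift ℂ s).toLinearMap,
      fun a b ↦ by simpa using hm (FreeAlgebra.lift ℂ s a) (FreeAlgebra.lift ℂ s b)⟩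
  exact Filter.mem_of_superset ((isOpen_lt hc continuous_const).mem_nhds
    (by simp : p.comp (FreeAlgebra.lift ℂ s).toLinearMap 0 < 1)) fun x hx ↦ hpU hx

/-- The substitution of elements of an Arens–Michael algebra into free entire functions. -/
def lift (hB : IsArensMichael B) (s : Fin n → B) : FreeEntire n →A[ℂ] B :=
  have := hB.complete
  have := hB.hausdorff
  { Completion.extensionHom (FreeAlgebra.lift ℂ s).toRingHom
      (continuous_freeAlgebraLift hB s) with
    commutes' := fun c ↦
      (Completion.extensionHom_coe (FreeAlgebra.lift ℂ s).toRingHom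
        (continuous_freeAlgebraLift hB s) (algebraMap ℂ _ c)).trans
        ((FreeAlgebra.lift ℂ s).commutes c)
    cont := Completion.continuous_extension }

theorem lift_gen (hB : IsArensMichael B) (s : Fin n → B) (i : Fin n) :
    lift hB s (gen i) = s i :=
  have := hB.complete
  have := hB.hausdorff
  (Completion.extensionHom_coe (FreeAlgebra.lift ℂ s).toRingHom
    (continuous_freeAlgebraLift hB s) (FreeAlgebra.ι ℂ i)).trans (FreeAlgebra.lift_ι_apply s i)

variable (n) in
/-- The canonical homomorphism from the free algebra to its completion. -/
def ofFreeAlgebra : FreeAlgebra ℂ (Fin n) →ₐ[ℂ] FreeEntire n :=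
  { Completion.coeRingHom with commutes' := fun _ ↦ rfl }

theorem hom_ext {E : Type*} [Ring E] [Algebra ℂ E] [TopologicalSpace E] [T2Space E]
    {f g : FreeEntire n →A[ℂ] E} (h : ∀ i, f (gen i) = g (gen i)) : f = g := by
  have h' : (f : FreeEntire n →ₐ[ℂ] E).comp (ofFreeAlgebra n) =
      (g : FreeEntire n →ₐ[ℂ] E).comp (ofFreeAlgebra n) :=
    FreeAlgebra.hom_ext (funext h)
  ext t
  induction t using Completion.induction_on with
  | hp => exact isClosed_eq f.continuous g.continuous
  | ih u => exact DFunLike.congr_fun h' u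

end FreeEntire

namespace AfTilde

variable {q : ℂ}

theorem isArensMichael : IsArensMichael (AfTilde q) :=
  (FreeEntire.isArensMichael 2).of_isOpenQuotientMap (proj q) (isOpenQuotientMap_proj q)

variable (q) in
/-- The quotient homomorphism as a continuous homomorphism. -/
def projL : FreeEntire 2 →A[ℂ] AfTilde q := ⟨proj q, continuous_proj q⟩

theorem hom_ext {E : Type*} [Ring E] [Algebra ℂ E] [TopologicalSpace E] [T2Space E]
    {f g : AfTilde q →A[ℂ] E} (hz : f (z q) = g (z q)) (hb : f (b q) = g (b q)) : f = g := by
  have h : f.comp (projL q) = g.comp (projL q) :=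
    FreeEntire.hom_ext fun i ↦ by fin_cases i; exacts [hz, hb]
  ext x
  obtain ⟨y, rfl⟩ := surjective_proj q x
  exact DFunLike.congr_fun h y

theorem exp_z_mul_b : NormedSpace.exp (z q) * b q = q • (b q * NormedSpace.exp (z q)) := by
  have h : projL q (NormedSpace.exp (FreeEntire.gen 0) * FreeEntire.gen 1 -
      q • (FreeEntire.gen 1 * NormedSpace.exp (FreeEntire.gen 0))) = 0 :=
    Ideal.Quotient.eq_zero_iff_mem.2
      (subset_closure (TwoSidedIdeal.mem_asIdeal.2 (TwoSidedIdeal.subset_span rfl)))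
  rw [map_sub, map_smul, map_mul, map_mul, (projL q).map_exp (FreeEntire.isArensMichael 2),
    sub_eq_zero] at h
  exact h

/-- The kernel of a continuous homomorphism is a closed ideal, so it contains the ideal of relations
as soon as the images of the generators satisfy the relation. -/
theorem eq_zero_of_mem_afIdeal {E : Type*} [Ring E] [Algebra ℂ E] [TopologicalSpace E]
    [IsTopologicalRing E] [T2Space E] {f : FreeEntire 2 →A[ℂ] E}
    (h : NormedSpace.exp (f (FreeEntire.gen 0)) * f (FreeEntire.gen 1) =
      q • (f (FreeEntire.gen 1) * NormedSpace.exp (f (FreeEntire.gen 0)))) :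
    ∀ a ∈ afIdeal q, f a = 0 := by
  set r : FreeEntire 2 := NormedSpace.exp (FreeEntire.gen 0) * FreeEntire.gen 1 -
    q • (FreeEntire.gen 1 * NormedSpace.exp (FreeEntire.gen 0)) with hr
  have hle : TwoSidedIdeal.span {r} ≤ TwoSidedIdeal.ker f := by
    rw [TwoSidedIdeal.span_le]
    rintro _ rfl
    rw [SetLike.mem_coe, TwoSidedIdeal.mem_ker, hr, map_sub, map_smul, map_mul, map_mul,
      f.map_exp (FreeEntire.isArensMichael 2), h, sub_self]
  exact fun a ha ↦ closure_minimal
    (fun a ha ↦ (TwoSidedIdeal.mem_ker f).1 (hle (TwoSidedIdeal.mem_asIdeal.1 ha)))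
    (isClosed_eq f.continuous continuous_const) ha

/-- The continuous homomorphism from `𝒪(Ãf₁)_q` to an Arens–Michael algebra given by two elements
that satisfy the defining relation. -/
def lift (hB : IsArensMichael B) (x y : B)
    (h : NormedSpace.exp x * y = q • (y * NormedSpace.exp x)) : AfTilde q →A[ℂ] B :=
  have := hB.hausdorff
  let φ : AfTilde q →ₐ[ℂ] B := Ideal.Quotient.liftₐ (afIdeal q)
    (FreeEntire.lift hB ![x, y] : FreeEntire 2 →ₐ[ℂ] B)
    (eq_zero_of_mem_afIdeal (by simpa [FreeEntire.lift_gen] using h))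
  { φ with
    cont := (isOpenQuotientMap_proj q).isQuotientMap.continuous_iff.2
      (FreeEntire.lift hB ![x, y]).continuous }

section Lift

variable (hB : IsArensMichael B) {x y : B}
  (h : NormedSpace.exp x * y = q • (y * NormedSpace.exp x))

@[simp]
theorem lift_z : lift hB x y h (z q) = x :=
  FreeEntire.lift_gen hB ![x, y] 0

@[simp]
theorem lift_b : lift hB x y h (b q) = y :=
  FreeEntire.lift_gen hB ![x, y] 1

end Lift

theorem isHFG : IsHFG (AfTilde q) where
  arensMichael := isArensMichael
  firstCountable := by
    have h := (isOpenQuotientMap_proj q)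
    have : (𝓝 (0 : AfTilde q)).IsCountablyGenerated := by
      rw [← map_zero (proj q), ← h.map_nhds_eq]
      infer_instance
    have : (uniformity (AfTilde q)).IsCountablyGenerated :=
      IsUniformAddGroup.uniformity_countably_generated
    exact UniformSpace.firstCountableTopology _
  generated := ⟨2, projL q, surjective_proj q⟩

theorem topologicalClosure_adjoin : (Algebra.adjoin ℂ {z q, b q}).topologicalClosure = ⊤ := by
  set S := Algebra.adjoin ℂ {z q, b q} with hS
  have hfree : ∀ u, proj q (FreeEntire.ofFreeAlgebra 2 u) ∈ S := by
    have hle : (⊤ : Subalgebra ℂ (FreeAlgebra ℂ (Fin 2))) ≤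
        S.comap ((proj q).comp (FreeEntire.ofFreeAlgebra 2)) := by
      rw [← FreeAlgebra.adjoin_range_ι, Algebra.adjoin_le_iff]
      rintro _ ⟨i, rfl⟩
      refine Algebra.subset_adjoin ?_
      fin_cases i
      exacts [Or.inl rfl, Or.inr rfl]
    exact fun u ↦ hle (x := u) trivial
  refine Algebra.eq_top_iff.2 fun x ↦ ?_
  obtain ⟨y, rfl⟩ := surjective_proj q x
  induction y using Completion.induction_on with
  | hp => exact S.isClosed_topologicalClosure.preimage (continuous_proj q)
  | ih u => exact S.le_topologicalClosure (hfree u)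

theorem isUniversalAf : IsUniversalAf.{u} q (AfTilde q) (z q) (b q) where
  isHFG := isHFG
  generates := topologicalClosure_adjoin
  relation := exp_z_mul_b
  existsUnique_hom B _ _ _ _ _ _ hB x y h :=
    ⟨lift hB.arensMichael x y h, ⟨lift_z _ h, lift_b _ h⟩, fun φ hφ ↦
      have := hB.arensMichael.hausdorff
      hom_ext (by rw [hφ.1, lift_z]) (by rw [hφ.2, lift_b])⟩

theorem not_finiteDimensional : ¬ FiniteDimensional ℂ (AfTilde q) := by
  intro hfin
  obtain ⟨P, hP, hz⟩ := IsIntegral.of_finite ℂ (z q)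
  refine hP.ne_zero (Polynomial.funext fun c ↦ ?_)
  -- Every complex number is a root of a polynomial that annihilates `z`.
  let f : AfTilde q →A[ℂ] ℂ := lift isArensMichael_complex c 0 (by simp)
  have h := congr_arg f hz
  rw [← Polynomial.aeval_def, map_zero] at h
  have h2 : f (Polynomial.aeval (z q) P) = Polynomial.aeval (f (z q)) P :=
    (Polynomial.aeval_algHom_apply (f : AfTilde q →ₐ[ℂ] ℂ) (z q) P).symm
  rw [h2, lift_z] at h
  simpa using h

end AfTilde

end UniversalProperty

/-! ### Homomorphisms between completed tensor products -/

namespace CTensor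

section Induction

variable {A B : Type*} [AddCommGroup A] [Module ℂ A] [TopologicalSpace A]
  [AddCommGroup B] [Module ℂ B] [TopologicalSpace B]

theorem induction {P : CTensor A B → Prop} (hP : IsClosed {t | P t})
    (add : ∀ t u, P t → P u → P (t + u)) (tmul : ∀ a b, P (tmul a b)) (t : CTensor A B) : P t := by
  induction t using Completion.induction_on with
  | hp => exact hP
  | ih u =>
    induction u using TensorProduct.induction_on with
    | zero => simpa [tmul_eq_coe] using tmul 0 0
    | tmul a b => exact tmul a b
    | add u v hu hv => rw [Completion.coe_add]; exact add _ _ hu hv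

end Induction

section Multiplication

variable {A B : Type*} [Ring A] [Algebra ℂ A] [TopologicalSpace A] [Ring B] [Algebra ℂ B]
  [TopologicalSpace B]

theorem one_def : (1 : CTensor A B) = tmul 1 1 := rfl

variable [IsTopologicalRing A] [PolynormableSpace ℂ A] [IsTopologicalRing B] [PolynormableSpace ℂ B]

theorem tmul_mul_tmul (a a' : A) (b b' : B) :
    tmul a b * tmul a' b' = tmul (a * a') (b * b') := by
  rw [tmul_eq_coe, tmul_eq_coe, ← Completion.coe_mul, Algebra.TensorProduct.tmul_mul_tmul]
  rfl

end Multiplication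

section Homomorphisms

variable {A B C D E : Type*}
  [Ring A] [Algebra ℂ A] [TopologicalSpace A] [IsTopologicalRing A] [PolynormableSpace ℂ A]
  [Ring B] [Algebra ℂ B] [TopologicalSpace B] [IsTopologicalRing B] [PolynormableSpace ℂ B]
  [Ring C] [Algebra ℂ C] [TopologicalSpace C] [IsTopologicalRing C] [PolynormableSpace ℂ C]
  [Ring D] [Algebra ℂ D] [TopologicalSpace D] [IsTopologicalRing D] [PolynormableSpace ℂ D]
  [Ring E] [Algebra ℂ E] [TopologicalSpace E] [IsTopologicalRing E] [T2Space E]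

/-- A continuous linear map on `A ⊗̂ B` that is multiplicative on elementary tensors is a
homomorphism. -/
def algHomOfTmul (f : CTensor A B →L[ℂ] E) (one : f (tmul 1 1) = 1)
    (mul : ∀ a b a' b', f (tmul (a * a') (b * b')) = f (tmul a b) * f (tmul a' b')) :
    CTensor A B →A[ℂ] E where
  toAlgHom := AlgHom.ofLinearMap f.toLinearMap one fun t u ↦ by
    change f (t * u) = f t * f u
    induction t using CTensor.induction with
    | hP =>
      exact isClosed_eq (f.continuous.comp (continuous_mul_const u))
        (f.continuous.mul continuous_const)
    | add t t' ht ht' => rw [add_mul, map_add, map_add, add_mul, ht, ht']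
    | tmul a b =>
      induction u using CTensor.induction with
      | hP =>
        exact isClosed_eq (f.continuous.comp (continuous_const_mul _))
          (continuous_const.mul f.continuous)
      | add u u' hu hu' => rw [mul_add, map_add, map_add, mul_add, hu, hu']
      | tmul a' b' => rw [tmul_mul_tmul, mul]
  cont := f.continuous

/-- The homomorphism `a ↦ a ⊗ 1`. -/
def includeLeft : A →A[ℂ] CTensor A B where
  toAlgHom := AlgHom.ofLinearMap ((mk A B).flip 1) one_def.symm fun a a' ↦ by
    change tmul (a * a') 1 = tmul a 1 * tmul a' 1
    rw [tmul_mul_tmul, mul_one]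
  cont := (mkRight (B := A) (1 : B)).continuous

/-- The continuous linear map `b ↦ a ⊗ b`. -/
def mkLeft (a : A) : B →L[ℂ] CTensor A B where
  toLinearMap := mk A B a
  cont := continuous_tmul.comp (continuous_const.prodMk continuous_id)

/-- The homomorphism `b ↦ 1 ⊗ b`. -/
def includeRight : B →A[ℂ] CTensor A B where
  toAlgHom := AlgHom.ofLinearMap (mkLeft 1).toLinearMap one_def.symm fun b b' ↦ by
    change tmul 1 (b * b') = tmul 1 b * tmul 1 b'
    rw [tmul_mul_tmul, mul_one]
  cont := (mkLeft (B := B) (1 : A)).continuous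

/-- The map `Δ ⊗̂ 1 : A ⊗̂ D → (B ⊗̂ C) ⊗̂ D` for a homomorphism `Δ : A → B ⊗̂ C`, as a
homomorphism. -/
def mapLeftAlg (Δ : A →A[ℂ] CTensor B C) : CTensor A D →A[ℂ] CTensor (CTensor B C) D :=
  algHomOfTmul (map Δ.toContinuousLinearMap (ContinuousLinearMap.id ℂ D))
    (by rw [map_tmul]; exact congr_arg₂ tmul (map_one Δ) rfl)
    (fun a d a' d' ↦ by
      rw [map_tmul, map_tmul, map_tmul, tmul_mul_tmul]
      exact congr_arg₂ tmul (map_mul Δ a a') rfl)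

theorem mapLeftAlg_tmul (Δ : A →A[ℂ] CTensor B C) (a : A) (d : D) :
    mapLeftAlg Δ (tmul a d) = tmul (Δ a) d :=
  map_tmul _ _ a d

/-- The map `1 ⊗̂ Δ : D ⊗̂ A → D ⊗̂ (B ⊗̂ C)` for a homomorphism `Δ : A → B ⊗̂ C`, as a
homomorphism. -/
def mapRightAlg (Δ : A →A[ℂ] CTensor B C) : CTensor D A →A[ℂ] CTensor D (CTensor B C) :=
  algHomOfTmul (map (ContinuousLinearMap.id ℂ D) Δ.toContinuousLinearMap)
    (by rw [map_tmul]; exact congr_arg₂ tmul rfl (map_one Δ))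
    (fun d a d' a' ↦ by
      rw [map_tmul, map_tmul, map_tmul, tmul_mul_tmul]
      exact congr_arg₂ tmul rfl (map_mul Δ a a'))

theorem mapRightAlg_tmul (Δ : A →A[ℂ] CTensor B C) (d : D) (a : A) :
    mapRightAlg Δ (tmul d a) = tmul d (Δ a) :=
  map_tmul _ _ d a

variable (A B C) in
/-- The associativity map, as a homomorphism. -/
def assocAlg : CTensor (CTensor A B) C →A[ℂ] CTensor A (CTensor B C) :=
  algHomOfTmul assoc (by rw [one_def, assoc_tmul]; rfl) (fun t c t' c' ↦ by
    have hc (c : C) : Continuous fun t : CTensor A B ↦ assoc (tmul t c) :=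
      (assoc.comp (mkRight c)).continuous
    induction t using CTensor.induction with
    | hP =>
      exact isClosed_eq ((hc (c * c')).comp (continuous_mul_const t'))
        ((hc c).mul continuous_const)
    | add t u ht hu => rw [add_mul, add_tmul, add_tmul, map_add, map_add, add_mul, ht, hu]
    | tmul a b =>
      induction t' using CTensor.induction with
      | hP =>
        exact isClosed_eq ((hc (c * c')).comp (continuous_const_mul _))
          (continuous_const.mul (hc c'))
      | add t u ht hu => rw [mul_add, add_tmul, add_tmul, map_add, map_add, mul_add, ht, hu]
      | tmul a' b' =>
        rw [tmul_mul_tmul, assoc_tmul, assoc_tmul, assoc_tmul, tmul_mul_tmul, tmul_mul_tmul])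

theorem assocAlg_tmul (a : A) (b : B) (c : C) :
    assocAlg A B C (tmul (tmul a b) c) = tmul a (tmul b c) :=
  assoc_tmul a b c

end Homomorphisms

section Exponential

variable {A B : Type*}
  [Ring A] [Algebra ℂ A] [UniformSpace A] [IsUniformAddGroup A] [IsTopologicalRing A]
  [ContinuousSMul ℂ A] [PolynormableSpace ℂ A]
  [Ring B] [Algebra ℂ B]

theorem exp_tmul_one [TopologicalSpace B] [IsTopologicalRing B] [PolynormableSpace ℂ B]
    (hA : IsArensMichael A) (a : A) :
    NormedSpace.exp (tmul a 1 : CTensor A B) = tmul (NormedSpace.exp a) 1 :=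
  ((includeLeft (A := A) (B := B)).map_exp hA a).symm

theorem exp_one_tmul [TopologicalSpace B] [IsTopologicalRing B] [PolynormableSpace ℂ B]
    (hA : IsArensMichael A) (a : A) :
    NormedSpace.exp (tmul 1 a : CTensor B A) = tmul 1 (NormedSpace.exp a) :=
  ((includeRight (A := B) (B := A)).map_exp hA a).symm

variable [UniformSpace B] [IsUniformAddGroup B] [IsTopologicalRing B]
  [ContinuousSMul ℂ B] [PolynormableSpace ℂ B]

/-- The element `1 ⊗ x + x ⊗ 1` has a group-like exponential. -/
theorem exp_one_tmul_add_tmul_one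
    (hA : IsArensMichael A) (hB : IsArensMichael B) (a : A) (b : B) :
    NormedSpace.exp (tmul 1 b + tmul a 1 : CTensor A B) =
      tmul (NormedSpace.exp a) (NormedSpace.exp b) := by
  have hc : Commute (tmul 1 b : CTensor A B) (tmul a 1) := by
    rw [Commute, SemiconjBy, tmul_mul_tmul, tmul_mul_tmul]
    simp
  rw [(CTensor.isArensMichael hA hB).exp_add_of_commute hc, exp_one_tmul hB, exp_tmul_one hA,
    tmul_mul_tmul, one_mul, mul_one]

end Exponential

section Counit

variable {A : Type*} [Ring A] [Algebra ℂ A] [UniformSpace A] [IsUniformAddGroup A]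
  [IsTopologicalRing A] [UniformContinuousConstSMul ℂ A] [PolynormableSpace ℂ A]
  [CompleteSpace A] [T2Space A]

theorem evalLeft_tmul (f : A →L[ℂ] ℂ) (a a' : A) : evalLeft f (tmul a a') = f a • a' :=
  lift_tmul _ _ a a'

theorem evalRight_tmul (f : A →L[ℂ] ℂ) (a a' : A) : evalRight f (tmul a a') = f a' • a :=
  lift_tmul _ _ a a'

theorem mulMap_tmul (a a' : A) : mulMap A (tmul a a') = a * a' :=
  lift_tmul _ _ a a'

/-- The map `ε ⊗̂ 1 : A ⊗̂ A → A` for a character `ε`, as a homomorphism. -/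
def evalLeftAlg (f : A →A[ℂ] ℂ) : CTensor A A →A[ℂ] A :=
  algHomOfTmul (evalLeft f.toContinuousLinearMap)
    (by rw [evalLeft_tmul]; exact (congr_arg (· • (1 : A)) (map_one f)).trans (one_smul _ _))
    (fun a b a' b' ↦ by
      rw [evalLeft_tmul, evalLeft_tmul, evalLeft_tmul, smul_mul_smul_comm]
      exact congr_arg (· • (b * b')) (map_mul f a a'))

theorem evalLeftAlg_tmul (f : A →A[ℂ] ℂ) (a a' : A) :
    evalLeftAlg f (tmul a a') = f a • a' :=
  evalLeft_tmul _ a a'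

/-- The map `1 ⊗̂ ε : A ⊗̂ A → A` for a character `ε`, as a homomorphism. -/
def evalRightAlg (f : A →A[ℂ] ℂ) : CTensor A A →A[ℂ] A :=
  algHomOfTmul (evalRight f.toContinuousLinearMap)
    (by rw [evalRight_tmul]; exact (congr_arg (· • (1 : A)) (map_one f)).trans (one_smul _ _))
    (fun a b a' b' ↦ by
      rw [evalRight_tmul, evalRight_tmul, evalRight_tmul, smul_mul_smul_comm]
      exact congr_arg (· • (a * a')) (map_mul f b b'))

theorem evalRightAlg_tmul (f : A →A[ℂ] ℂ) (a a' : A) :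
    evalRightAlg f (tmul a a') = f a' • a :=
  evalRight_tmul _ a a'

end Counit

end CTensor

/-! ### Antihomomorphisms -/

section Antihomomorphism

/-- In the opposite algebra, the relation `e^x y = q y e^x` reads `y e^x = q e^x y`. -/
theorem op_relation {q : ℂ} {E : Type*} [Ring E] [Algebra ℂ E] [TopologicalSpace E]
    [IsTopologicalRing E] [T2Space E] {x y : E}
    (h : y * NormedSpace.exp x = q • (NormedSpace.exp x * y)) :
    NormedSpace.exp (MulOpposite.op x) * MulOpposite.op y =
      q • (MulOpposite.op y * NormedSpace.exp (MulOpposite.op x)) := by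
  rw [NormedSpace.exp_op, ← MulOpposite.op_mul, h, ← MulOpposite.op_mul, MulOpposite.op_smul]

/-- A continuous unital antihomomorphism, as a homomorphism to the opposite algebra. -/
def opAlgHom {A E : Type*} [Ring A] [Algebra ℂ A] [TopologicalSpace A] [Ring E] [Algebra ℂ E]
    [TopologicalSpace E] (S : A →L[ℂ] E) (one : S 1 = 1) (mul : ∀ x y, S (x * y) = S y * S x) :
    A →A[ℂ] Eᵐᵒᵖ where
  toAlgHom := AlgHom.ofLinearMap ((MulOpposite.opLinearEquiv ℂ).toLinearMap ∘ₗ S.toLinearMap)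
    (congr_arg MulOpposite.op one) fun x y ↦ congr_arg MulOpposite.op (mul x y)
  cont := MulOpposite.continuous_op.comp S.continuous

theorem map_exp_of_antihom {A E : Type*} [Ring A] [Algebra ℂ A] [UniformSpace A]
    [IsUniformAddGroup A] [IsTopologicalRing A] [ContinuousSMul ℂ A] [Ring E] [Algebra ℂ E]
    [TopologicalSpace E] [IsTopologicalRing E] [T2Space E] (hA : IsArensMichael A)
    (S : A →L[ℂ] E) (one : S 1 = 1) (mul : ∀ x y, S (x * y) = S y * S x) (a : A) :
    S (NormedSpace.exp a) = NormedSpace.exp (S a) := by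
  have h := (opAlgHom S one mul).map_exp hA a
  exact MulOpposite.op_injective (h.trans (NormedSpace.exp_op (S a)))

end Antihomomorphism

/-! ### The universal Arens–Michael algebra of the relation -/

/-- `A` is the universal Arens–Michael algebra generated by `z` and `b` subject to the relation
`e^z b = q b e^z`. In contrast to `IsUniversalAf`, the target algebras need not be holomorphically
finitely generated, so that the completed tensor products of `A` are among them. -/
structure IsArensMichaelUniversal (q : ℂ) {A : Type} [Ring A] [Algebra ℂ A] [UniformSpace A]
    [IsUniformAddGroup A] [IsTopologicalRing A] [ContinuousSMul ℂ A] (z b : A) : Prop where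
  isArensMichael : IsArensMichael A
  generates : (Algebra.adjoin ℂ {z, b}).topologicalClosure = ⊤
  relation : NormedSpace.exp z * b = q • (b * NormedSpace.exp z)
  exists_hom : ∀ {B : Type} [Ring B] [Algebra ℂ B] [UniformSpace B] [IsUniformAddGroup B]
    [IsTopologicalRing B] [ContinuousSMul ℂ B], IsArensMichael B → ∀ x y : B,
    NormedSpace.exp x * y = q • (y * NormedSpace.exp x) → ∃ φ : A →A[ℂ] B, φ z = x ∧ φ b = y

namespace IsArensMichaelUniversal

section Antihomomorphism

variable {q : ℂ} {A : Type} [Ring A] [Algebra ℂ A] [UniformSpace A] [IsUniformAddGroup A]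
  [IsTopologicalRing A] [ContinuousSMul ℂ A] {z b : A} (hA : IsArensMichaelUniversal q z b)

/-- A closed set that contains `z`, `b` and the scalars and is stable under sums and products is
everything. -/
theorem induction_on_generators (hA : IsArensMichaelUniversal q z b) {P : A → Prop}
    (closed : IsClosed {a | P a}) (algebraMap : ∀ c : ℂ, P (algebraMap ℂ _ c))
    (add : ∀ a a', P a → P a' → P (a + a')) (mul : ∀ a a', P a → P a' → P (a * a'))
    (hz : P z) (hb : P b) (a : A) : P a := by
  let S : Subalgebra ℂ A :=
    { carrier := {a | P a}
      mul_mem' := mul _ _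
      add_mem' := add _ _
      algebraMap_mem' := algebraMap }
  have hle : Algebra.adjoin ℂ {z, b} ≤ S :=
    Algebra.adjoin_le (by rintro _ (rfl | rfl); exacts [hz, hb])
  have h := Subalgebra.topologicalClosure_minimal hle closed
  rw [hA.generates] at h
  exact h (x := a) trivial

theorem hom_ext (hA : IsArensMichaelUniversal q z b) {E : Type*} [Ring E] [Algebra ℂ E]
    [TopologicalSpace E] [T2Space E] {f g : A →A[ℂ] E} (hz : f z = g z) (hb : f b = g b) :
    f = g := by
  ext a
  refine hA.induction_on_generators (P := fun a ↦ f a = g a)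
    (isClosed_eq f.continuous g.continuous) (fun c ↦ ?_) (fun a a' h h' ↦ ?_)
    (fun a a' h h' ↦ ?_) hz hb a
  · exact (f.toAlgHom.commutes c).trans (g.toAlgHom.commutes c).symm
  · rw [map_add, map_add, h, h']
  · rw [map_mul, map_mul, h, h']

theorem b_mul_exp_neg (hA : IsArensMichaelUniversal q z b) :
    b * NormedSpace.exp (-z) = q • (NormedSpace.exp (-z) * b) := by
  calc b * NormedSpace.exp (-z)
      = NormedSpace.exp (-z) * (NormedSpace.exp z * b) * NormedSpace.exp (-z) := by
        rw [← mul_assoc, hA.isArensMichael.exp_neg_mul_exp, one_mul]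
    _ = q • (NormedSpace.exp (-z) * b * (NormedSpace.exp z * NormedSpace.exp (-z))) := by
        rw [hA.relation, mul_smul_comm, smul_mul_assoc]
        simp only [mul_assoc]
    _ = _ := by rw [hA.isArensMichael.exp_mul_exp_neg, mul_one]

section Lift

variable {B : Type} [Ring B] [Algebra ℂ B] [UniformSpace B] [IsUniformAddGroup B]
  [IsTopologicalRing B] [ContinuousSMul ℂ B]

/-- The homomorphism to an Arens–Michael algebra given by two elements that satisfy the relation;
the choice is unique by `hom_ext`. -/
def lift (hA : IsArensMichaelUniversal q z b) (hB : IsArensMichael B) (x y : B)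
    (h : NormedSpace.exp x * y = q • (y * NormedSpace.exp x)) : A →A[ℂ] B :=
  (hA.exists_hom hB x y h).choose

theorem lift_z (hB : IsArensMichael B) {x y : B}
    (h : NormedSpace.exp x * y = q • (y * NormedSpace.exp x)) : hA.lift hB x y h z = x :=
  (hA.exists_hom hB x y h).choose_spec.1

theorem lift_b (hB : IsArensMichael B) {x y : B}
    (h : NormedSpace.exp x * y = q • (y * NormedSpace.exp x)) : hA.lift hB x y h b = y :=
  (hA.exists_hom hB x y h).choose_spec.2

/-- The continuous unital antihomomorphism to an Arens–Michael algebra `B` given by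
two elements that satisfy the opposite of the defining relation: the homomorphism to the opposite
algebra of `B`, as a linear map to `B`. -/
def antiLift (hA : IsArensMichaelUniversal q z b) (hB : IsArensMichael B) (x y : B)
    (h : y * NormedSpace.exp x = q • (NormedSpace.exp x * y)) : A →L[ℂ] B :=
  have := hB.hausdorff
  (MulOpposite.opContinuousLinearEquiv ℂ : B ≃L[ℂ] Bᵐᵒᵖ).symm.toContinuousLinearMap.comp
    (hA.lift hB.mulOpposite (MulOpposite.op x) (MulOpposite.op y)
      (op_relation h)).toContinuousLinearMap

variable (hB : IsArensMichael B) {x y : B}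
  (h : y * NormedSpace.exp x = q • (NormedSpace.exp x * y))

theorem antiLift_z : hA.antiLift hB x y h z = x :=
  have := hB.hausdorff
  congr_arg MulOpposite.unop (hA.lift_z hB.mulOpposite (op_relation h))

theorem antiLift_b : hA.antiLift hB x y h b = y :=
  have := hB.hausdorff
  congr_arg MulOpposite.unop (hA.lift_b hB.mulOpposite (op_relation h))

theorem antiLift_one : hA.antiLift hB x y h 1 = 1 :=
  have := hB.hausdorff
  congr_arg MulOpposite.unop (map_one (hA.lift hB.mulOpposite _ _ (op_relation h)))

theorem antiLift_mul (a a' : A) :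
    hA.antiLift hB x y h (a * a') = hA.antiLift hB x y h a' * hA.antiLift hB x y h a :=
  have := hB.hausdorff
  congr_arg MulOpposite.unop (map_mul (hA.lift hB.mulOpposite _ _ (op_relation h)) a a')

end Lift

/-- Continuous unital antihomomorphisms are determined by the images of `z` and `b`. -/
theorem antihom_ext (hA : IsArensMichaelUniversal q z b) {E : Type*} [Ring E] [Algebra ℂ E]
    [TopologicalSpace E] [T2Space E]
    {S T : A →L[ℂ] E} (hS1 : S 1 = 1) (hT1 : T 1 = 1)
    (hS : ∀ x y, S (x * y) = S y * S x) (hT : ∀ x y, T (x * y) = T y * T x)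
    (hz : S z = T z) (hb : S b = T b) : S = T := by
  have h : opAlgHom S hS1 hS = opAlgHom T hT1 hT :=
    hA.hom_ext (congr_arg MulOpposite.op hz) (congr_arg MulOpposite.op hb)
  ext a
  exact congr_arg MulOpposite.unop (DFunLike.congr_fun h a)

/-- The composition of two antihomomorphisms that fixes `z` and `b` is the identity. -/
theorem antihom_comp_eq_id (hA : IsArensMichaelUniversal q z b) {S T : A →L[ℂ] A}
    (hS1 : S 1 = 1) (hT1 : T 1 = 1)
    (hS : ∀ x y, S (x * y) = S y * S x) (hT : ∀ x y, T (x * y) = T y * T x)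
    (hz : S (T z) = z) (hb : S (T b) = b) (a : A) : S (T a) = a := by
  let f : A →A[ℂ] A :=
    { toAlgHom := AlgHom.ofLinearMap (S.toLinearMap ∘ₗ T.toLinearMap)
        (show S (T 1) = 1 by rw [hT1, hS1])
        (fun x y ↦ show S (T (x * y)) = S (T x) * S (T y) by rw [hT, hS])
      cont := S.continuous.comp T.continuous }
  have := hA.isArensMichael.hausdorff
  have h : f = ContinuousAlgHom.id ℂ A := hA.hom_ext hz hb
  exact DFunLike.congr_fun h a

end Antihomomorphism

/-! ### The counit, the antipode and its inverse -/

section Antipode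

variable {q : ℂ} {A : Type} [Ring A] [Algebra ℂ A] [UniformSpace A] [IsUniformAddGroup A]
  [IsTopologicalRing A] [ContinuousSMul ℂ A] {z b : A}
  (hA : IsArensMichaelUniversal q z b)

/-- The counit: the character that vanishes at `z` and `b`. -/
def counit : A →A[ℂ] ℂ := hA.lift isArensMichael_complex 0 0 (by simp)

theorem antipode_relation (hA : IsArensMichaelUniversal q z b) :
    -(NormedSpace.exp (-z) * b) * NormedSpace.exp (-z) =
    q • (NormedSpace.exp (-z) * -(NormedSpace.exp (-z) * b)) := by
  rw [neg_mul, mul_assoc, hA.b_mul_exp_neg, mul_smul_comm, mul_neg, smul_neg]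

/-- The antipode: the antihomomorphism `z ↦ -z`, `b ↦ -e^{-z} b`. -/
def antipode : A →L[ℂ] A :=
  hA.antiLift hA.isArensMichael (-z) (-(NormedSpace.exp (-z) * b)) hA.antipode_relation

/-- The inverse of the antipode: the antihomomorphism `z ↦ -z`, `b ↦ -b e^{-z}`. -/
def antipodeInv : A →L[ℂ] A :=
  hA.antiLift hA.isArensMichael (-z) (-(b * NormedSpace.exp (-z))) (by
    rw [hA.b_mul_exp_neg, ← smul_neg, smul_mul_assoc, mul_smul_comm, hA.antipode_relation])

theorem counit_z : hA.counit z = 0 := hA.lift_z _ _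

theorem counit_b : hA.counit b = 0 := hA.lift_b _ _

theorem counit_exp_z : hA.counit (NormedSpace.exp z) = 1 := by
  rw [hA.counit.map_exp hA.isArensMichael, hA.counit_z, NormedSpace.exp_zero]

theorem antipode_z : hA.antipode z = -z := hA.antiLift_z _ _

theorem antipode_b : hA.antipode b = -(NormedSpace.exp (-z) * b) := hA.antiLift_b _ _

theorem antipode_one : hA.antipode 1 = 1 := hA.antiLift_one _ _

theorem antipode_mul (x y : A) : hA.antipode (x * y) = hA.antipode y * hA.antipode x :=
  hA.antiLift_mul _ _ x y

theorem antipode_exp (x : A) :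
    hA.antipode (NormedSpace.exp x) = NormedSpace.exp (hA.antipode x) :=
  have := hA.isArensMichael.hausdorff
  map_exp_of_antihom hA.isArensMichael _ hA.antipode_one hA.antipode_mul x

theorem antipodeInv_z : hA.antipodeInv z = -z := hA.antiLift_z _ _

theorem antipodeInv_b : hA.antipodeInv b = -(b * NormedSpace.exp (-z)) := hA.antiLift_b _ _

theorem antipodeInv_one : hA.antipodeInv 1 = 1 := hA.antiLift_one _ _

theorem antipodeInv_mul (x y : A) :
    hA.antipodeInv (x * y) = hA.antipodeInv y * hA.antipodeInv x :=
  hA.antiLift_mul _ _ x y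

theorem antipodeInv_exp (x : A) :
    hA.antipodeInv (NormedSpace.exp x) = NormedSpace.exp (hA.antipodeInv x) :=
  have := hA.isArensMichael.hausdorff
  map_exp_of_antihom hA.isArensMichael _ hA.antipodeInv_one hA.antipodeInv_mul x

theorem antipodeInv_antipode (x : A) : hA.antipodeInv (hA.antipode x) = x := by
  refine hA.antihom_comp_eq_id hA.antipodeInv_one hA.antipode_one hA.antipodeInv_mul
    hA.antipode_mul ?_ ?_ x
  · rw [hA.antipode_z, map_neg, hA.antipodeInv_z, neg_neg]
  · rw [hA.antipode_b, map_neg, hA.antipodeInv_mul, hA.antipodeInv_exp, map_neg, hA.antipodeInv_z,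
      hA.antipodeInv_b, neg_neg, neg_mul, neg_neg, mul_assoc, hA.isArensMichael.exp_neg_mul_exp,
      mul_one]

theorem antipode_antipodeInv (x : A) : hA.antipode (hA.antipodeInv x) = x := by
  refine hA.antihom_comp_eq_id hA.antipode_one hA.antipodeInv_one hA.antipode_mul
    hA.antipodeInv_mul ?_ ?_ x
  · rw [hA.antipodeInv_z, map_neg, hA.antipode_z, neg_neg]
  · rw [hA.antipodeInv_b, map_neg, hA.antipode_mul, hA.antipode_exp, map_neg, hA.antipode_z,
      hA.antipode_b, neg_neg, mul_neg, neg_neg, ← mul_assoc, hA.isArensMichael.exp_mul_exp_neg, one_mul]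

end Antipode

/-! ### The comultiplication and the Hopf algebra axioms -/

section Hopf

variable {q : ℂ} {A : Type} [Ring A] [Algebra ℂ A] [UniformSpace A] [IsUniformAddGroup A]
  [IsTopologicalRing A] [ContinuousSMul ℂ A] [PolynormableSpace ℂ A] {z b : A}
  (hA : IsArensMichaelUniversal q z b)

/-- The comultiplication: the homomorphism `z ↦ 1 ⊗ z + z ⊗ 1`, `b ↦ e^z ⊗ b + b ⊗ 1`. -/
def comul : A →A[ℂ] CTensor A A :=
  hA.lift (CTensor.isArensMichael hA.isArensMichael hA.isArensMichael)
    (CTensor.tmul 1 z + CTensor.tmul z 1)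
    (CTensor.tmul (NormedSpace.exp z) b + CTensor.tmul b 1) (by
      rw [CTensor.exp_one_tmul_add_tmul_one hA.isArensMichael hA.isArensMichael, mul_add, add_mul,
        CTensor.tmul_mul_tmul, CTensor.tmul_mul_tmul, CTensor.tmul_mul_tmul,
        CTensor.tmul_mul_tmul, hA.relation, CTensor.tmul_smul, CTensor.smul_tmul, smul_add,
        mul_one, one_mul])

theorem comul_z : hA.comul z = CTensor.tmul 1 z + CTensor.tmul z 1 := hA.lift_z _ _

theorem comul_b : hA.comul b =
    CTensor.tmul (NormedSpace.exp z) b + CTensor.tmul b 1 := hA.lift_b _ _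

theorem comul_exp_z : hA.comul (NormedSpace.exp z) =
    CTensor.tmul (NormedSpace.exp z) (NormedSpace.exp z) := by
  rw [hA.comul.map_exp hA.isArensMichael, hA.comul_z,
    CTensor.exp_one_tmul_add_tmul_one hA.isArensMichael hA.isArensMichael]

theorem comul_coassoc (a : A) :
    CTensor.assoc (CTensor.map hA.comul.toContinuousLinearMap
      (ContinuousLinearMap.id ℂ A) (hA.comul a)) =
    CTensor.map (ContinuousLinearMap.id ℂ A) hA.comul.toContinuousLinearMap
      (hA.comul a) := by
  have h : ((CTensor.assocAlg A A A).comp (CTensor.mapLeftAlg hA.comul)).comp hA.comul =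
      (CTensor.mapRightAlg hA.comul).comp hA.comul := by
    refine hA.hom_ext ?_ ?_
    · simp only [ContinuousAlgHom.comp_apply, hA.comul_z, map_add, CTensor.mapLeftAlg_tmul,
        CTensor.mapRightAlg_tmul, map_one, CTensor.one_def, CTensor.add_tmul, CTensor.tmul_add,
        CTensor.assocAlg_tmul, add_assoc]
    · simp only [ContinuousAlgHom.comp_apply, hA.comul_b, hA.comul_exp_z, map_add,
        CTensor.mapLeftAlg_tmul, CTensor.mapRightAlg_tmul, map_one, CTensor.one_def,
        CTensor.add_tmul, CTensor.tmul_add, CTensor.assocAlg_tmul, add_assoc]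
  exact DFunLike.congr_fun h a

variable [UniformContinuousConstSMul ℂ A] [CompleteSpace A] [T2Space A]

theorem evalLeft_comul (a : A) :
    CTensor.evalLeft hA.counit.toContinuousLinearMap (hA.comul a) = a := by
  have h : (CTensor.evalLeftAlg hA.counit).comp hA.comul = ContinuousAlgHom.id ℂ _ := by
    refine hA.hom_ext ?_ ?_
    · simp [hA.comul_z, CTensor.evalLeftAlg_tmul, hA.counit_z]
    · simp [hA.comul_b, CTensor.evalLeftAlg_tmul, hA.counit_b, hA.counit_exp_z]
  exact DFunLike.congr_fun h a

theorem evalRight_comul (a : A) :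
    CTensor.evalRight hA.counit.toContinuousLinearMap (hA.comul a) = a := by
  have h : (CTensor.evalRightAlg hA.counit).comp hA.comul = ContinuousAlgHom.id ℂ _ := by
    refine hA.hom_ext ?_ ?_
    · simp [hA.comul_z, CTensor.evalRightAlg_tmul, hA.counit_z]
    · simp [hA.comul_b, CTensor.evalRightAlg_tmul, hA.counit_b]
  exact DFunLike.congr_fun h a

/-- The map `m ∘ (S ⊗̂ 1)`, `x ⊗ y ↦ S(x) y`, for the antipode `S`. -/
def antipodeMul : CTensor A A →L[ℂ] A :=
  (CTensor.mulMap A).comp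
    (CTensor.map hA.antipode (ContinuousLinearMap.id ℂ A))

/-- The map `m ∘ (1 ⊗̂ S)`, `x ⊗ y ↦ x S(y)`, for the antipode `S`. -/
def mulAntipode : CTensor A A →L[ℂ] A :=
  (CTensor.mulMap A).comp
    (CTensor.map (ContinuousLinearMap.id ℂ A) hA.antipode)

theorem antipodeMul_tmul (x y : A) :
    hA.antipodeMul (CTensor.tmul x y) = hA.antipode x * y := by
  rw [antipodeMul, ContinuousLinearMap.comp_apply, CTensor.map_tmul, CTensor.mulMap_tmul]
  rfl

theorem mulAntipode_tmul (x y : A) :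
    hA.mulAntipode (CTensor.tmul x y) = x * hA.antipode y := by
  rw [mulAntipode, ContinuousLinearMap.comp_apply, CTensor.map_tmul, CTensor.mulMap_tmul]
  rfl

theorem antipodeMul_mul_tmul (t : CTensor A A) (x y : A) :
    hA.antipodeMul (t * CTensor.tmul x y) = hA.antipode x * hA.antipodeMul t * y := by
  induction t using CTensor.induction with
  | hP =>
    exact isClosed_eq (hA.antipodeMul.continuous.comp (continuous_mul_const _))
      ((continuous_const.mul hA.antipodeMul.continuous).mul continuous_const)
  | add t u ht hu => rw [add_mul, map_add, map_add, ht, hu, mul_add, add_mul]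
  | tmul a a' =>
    rw [CTensor.tmul_mul_tmul, hA.antipodeMul_tmul, hA.antipodeMul_tmul, hA.antipode_mul]
    simp only [mul_assoc]

theorem mulAntipode_tmul_mul (t : CTensor A A) (x y : A) :
    hA.mulAntipode (CTensor.tmul x y * t) = x * hA.mulAntipode t * hA.antipode y := by
  induction t using CTensor.induction with
  | hP =>
    exact isClosed_eq (hA.mulAntipode.continuous.comp (continuous_const_mul _))
      ((continuous_const.mul hA.mulAntipode.continuous).mul continuous_const)
  | add t u ht hu => rw [mul_add, map_add, map_add, ht, hu, mul_add, add_mul]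
  | tmul a a' =>
    rw [CTensor.tmul_mul_tmul, hA.mulAntipode_tmul, hA.mulAntipode_tmul, hA.antipode_mul]
    simp only [mul_assoc]

/-- For `F = m ∘ (S ⊗̂ 1)`, a scalar `F(t)` can be moved in front of `F(t (x ⊗ y)) = S(x) F(t) y`,
which leaves `F(t) F(x ⊗ y)`. -/
theorem antipodeMul_mul {t : CTensor A A} {c : ℂ}
    (ht : hA.antipodeMul t = algebraMap ℂ A c) (u : CTensor A A) :
    hA.antipodeMul (t * u) = c • hA.antipodeMul u := by
  induction u using CTensor.induction with
  | hP =>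
    exact isClosed_eq (hA.antipodeMul.continuous.comp (continuous_const_mul _))
      (hA.antipodeMul.continuous.const_smul c)
  | add u v hu hv => rw [mul_add, map_add, map_add, hu, hv, smul_add]
  | tmul x y =>
    rw [hA.antipodeMul_mul_tmul, ht, hA.antipodeMul_tmul, ← Algebra.commutes, mul_assoc,
      Algebra.smul_def]

theorem mulAntipode_mul {t : CTensor A A} {c : ℂ}
    (ht : hA.mulAntipode t = algebraMap ℂ A c) (u : CTensor A A) :
    hA.mulAntipode (u * t) = c • hA.mulAntipode u := by
  induction u using CTensor.induction with
  | hP =>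
    exact isClosed_eq (hA.mulAntipode.continuous.comp (continuous_mul_const _))
      (hA.mulAntipode.continuous.const_smul c)
  | add u v hu hv => rw [add_mul, map_add, map_add, hu, hv, smul_add]
  | tmul x y =>
    rw [hA.mulAntipode_tmul_mul, ht, hA.mulAntipode_tmul, ← Algebra.commutes, mul_assoc,
      Algebra.smul_def]

theorem antipodeMul_comul (a : A) :
    hA.antipodeMul (hA.comul a) = algebraMap ℂ A (hA.counit a) := by
  induction a using hA.induction_on_generators with
  | closed =>
    exact isClosed_eq (hA.antipodeMul.continuous.comp hA.comul.continuous)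
      ((continuous_algebraMap ℂ A).comp hA.counit.continuous)
  | algebraMap c =>
    rw [Algebra.algebraMap_eq_smul_one, map_smul, map_smul, map_one, CTensor.one_def, map_smul,
      hA.antipodeMul_tmul, hA.antipode_one, map_one, mul_one, Algebra.algebraMap_eq_smul_one,
      smul_eq_mul, mul_one]
  | add a a' ha ha' => rw [map_add, map_add, map_add, map_add, ha, ha']
  | mul a a' ha ha' =>
    rw [map_mul, hA.antipodeMul_mul ha, ha', map_mul, map_mul, Algebra.smul_def]
  | hz =>
    rw [hA.comul_z, map_add, hA.antipodeMul_tmul, hA.antipodeMul_tmul, hA.antipode_one,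
      hA.antipode_z, hA.counit_z,
      map_zero, one_mul, mul_one, add_neg_cancel]
  | hb =>
    rw [hA.comul_b, map_add, hA.antipodeMul_tmul, hA.antipodeMul_tmul, hA.antipode_exp,
      hA.antipode_z,
      hA.antipode_b, hA.counit_b, map_zero, mul_one, add_neg_cancel]

theorem mulAntipode_comul (a : A) :
    hA.mulAntipode (hA.comul a) = algebraMap ℂ A (hA.counit a) := by
  induction a using hA.induction_on_generators with
  | closed =>
    exact isClosed_eq (hA.mulAntipode.continuous.comp hA.comul.continuous)
      ((continuous_algebraMap ℂ A).comp hA.counit.continuous)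
  | algebraMap c =>
    rw [Algebra.algebraMap_eq_smul_one, map_smul, map_smul, map_one, CTensor.one_def, map_smul,
      hA.mulAntipode_tmul, hA.antipode_one, map_one, mul_one, Algebra.algebraMap_eq_smul_one,
      smul_eq_mul, mul_one]
  | add a a' ha ha' => rw [map_add, map_add, map_add, map_add, ha, ha']
  | mul a a' ha ha' =>
    rw [map_mul, hA.mulAntipode_mul ha', ha, map_mul, map_mul, Algebra.smul_def, Algebra.commutes]
  | hz =>
    rw [hA.comul_z, map_add, hA.mulAntipode_tmul, hA.mulAntipode_tmul, hA.antipode_one,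
      hA.antipode_z, hA.counit_z,
      map_zero, one_mul, mul_one, neg_add_cancel]
  | hb =>
    rw [hA.comul_b, map_add, hA.mulAntipode_tmul, hA.mulAntipode_tmul, hA.antipode_one,
      hA.antipode_b, hA.counit_b, map_zero, mul_one, mul_neg, ← mul_assoc,
      hA.isArensMichael.exp_mul_exp_neg, one_mul,
      neg_add_cancel]

/-- The Hopf `⊗̂`-algebra structure. -/
def hopf (hA : IsArensMichaelUniversal q z b) : HopfCTensorAlgebra A where
  comul := hA.comul
  counit := hA.counit
  antipode := hA.antipode
  coassoc := hA.comul_coassoc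
  counit_left := hA.evalLeft_comul
  counit_right := hA.evalRight_comul
  antipode_left := hA.antipodeMul_comul
  antipode_right := hA.mulAntipode_comul

/-- The antipode as a topological linear automorphism. -/
def antipodeEquiv (hA : IsArensMichaelUniversal q z b) : A ≃L[ℂ] A :=
  ContinuousLinearEquiv.equivOfInverse hA.antipode hA.antipodeInv hA.antipodeInv_antipode
    hA.antipode_antipodeInv

end Hopf

end IsArensMichaelUniversal

/-! ### The Hopf algebra `𝒪(Ãf₁)_q` -/

namespace AfTilde

variable {q : ℂ}

theorem isArensMichaelUniversal : IsArensMichaelUniversal q (z q) (b q) where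
  isArensMichael := isArensMichael
  generates := topologicalClosure_adjoin
  relation := exp_z_mul_b
  exists_hom hB x y h := ⟨lift hB x y h, lift_z hB h, lift_b hB h⟩

variable (q) in
/-- The Hopf `⊗̂`-algebra structure of `𝒪(Ãf₁)_q`. -/
def hopf : HopfCTensorAlgebra (AfTilde q) := isArensMichaelUniversal.hopf

theorem hasAfFormulas_hopf : HasAfFormulas (hopf q) where
  comul_z := isArensMichaelUniversal.comul_z
  comul_b := isArensMichaelUniversal.comul_b
  counit_z := isArensMichaelUniversal.counit_z
  counit_b := isArensMichaelUniversal.counit_b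
  antipode_mul := isArensMichaelUniversal.antipode_mul
  antipode_one := isArensMichaelUniversal.antipode_one
  antipode_z := isArensMichaelUniversal.antipode_z
  antipode_b := isArensMichaelUniversal.antipode_b

theorem eq_of_hasAfFormulas {H H' : HopfCTensorAlgebra (AfTilde q)} (h : HasAfFormulas H)
    (h' : HasAfFormulas H') : H = H' := by
  have h1 : H.comul = H'.comul := isArensMichaelUniversal.hom_ext
    (h.comul_z.trans h'.comul_z.symm) (h.comul_b.trans h'.comul_b.symm)
  have h2 : H.counit = H'.counit := isArensMichaelUniversal.hom_ext
    (h.counit_z.trans h'.counit_z.symm) (h.counit_b.trans h'.counit_b.symm)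
  have h3 : H.antipode = H'.antipode :=
    isArensMichaelUniversal.antihom_ext h.antipode_one h'.antipode_one h.antipode_mul
      h'.antipode_mul (h.antipode_z.trans h'.antipode_z.symm)
      (h.antipode_b.trans h'.antipode_b.symm)
  cases H
  cases H'
  simp only at h1 h2 h3
  subst h1 h2 h3
  rfl

end AfTilde

end

theorem proposition5p7 (q : ℂ) (hq : q ≠ 0) :
    IsUniversalAf.{u} q (AfTilde q) (AfTilde.z q) (AfTilde.b q) ∧
    ¬ FiniteDimensional ℂ (AfTilde q) ∧
    ∃ H : HopfCTensorAlgebra (AfTilde q),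
      HasAfFormulas H ∧ (∀ H' : HopfCTensorAlgebra (AfTilde q), HasAfFormulas H' → H' = H) ∧
      ∃ T : AfTilde q ≃L[ℂ] AfTilde q, ∀ x, T x = H.antipode x := by
  exact ⟨AfTilde.isUniversalAf, AfTilde.not_finiteDimensional, AfTilde.hopf q,
    AfTilde.hasAfFormulas_hopf, fun _ h ↦ AfTilde.eq_of_hasAfFormulas h
      AfTilde.hasAfFormulas_hopf, AfTilde.isArensMichaelUniversal.antipodeEquiv, fun _ ↦ rfl⟩
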